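/- For a non-empty open set $\Omega\subset\mathbb{R}^m$ with finite Lebesgue measure $|\Omega|$ let $$\lambda_1(\Omega)=\inf_{\varphi\in H_0^1(\Omega)\setminus\{0\}}\frac{\int_\Omega|D\varphi|^2}{\int_\Omega\varphi^2},$$ let $v_\Omega$ be the torsion function of $\Omega$, i.e. the unique weak solution of $-\Delta v=1$, $v\in H_0^1(\Omega)$, and for $1\le p<\infty$ put $$F_p(\Omega)=\frac{\|v_\Omega\|_{L^p(\Omega)}\,\lambda_1(\Omega)}{|\Omega|^{1/p}}.$$ Let $$\mathfrak{G}_p=\inf\{F_p(\Omega):\Omega\subset\mathbb{R}^m\text{ open},\ 0<|\Omega|<\infty\},$$ $$\mathfrak{G}_p^{\mathrm{convex}}=\inf\{F_p(\Omega):\Omega\subset\mathbb{R}^m\text{ open and convex},\ 0<|\Omega|<\infty\}.$$ **Theorem.** Let $m\in\{1,2,3,\dots\}$ and $1\le p<\infty$. Then (i) $\mathfrak{G}_p=0$. (ii) The mapping $p\mapsto\mathfrak{G}_p^{\mathrm{convex}}$ is non-decreasing on $[1,\infty)$, and $$\mathfrak{G}_p^{\mathrm{convex}}\ \ge\ 2^{-3}\pi^2\,m^{-(m+2p)/p}\left(\frac{\Gamma(\frac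 m2+1)\,\Gamma(p+1)}{\Gamma(\frac m2+p+1)}\right)^{1/p}.$$ -/

import Mathlib

open MeasureTheory Filter Topology
open scoped ENNReal ContDiff

noncomputable section

namespace Torsion

variable {m : ℕ}

/-- `φ ∈ C_c^∞(Ω)`. -/
def IsTestFunction (Ω : Set (EuclideanSpace ℝ (Fin m))) (φ : EuclideanSpace ℝ (Fin m) → ℝ) :
    Prop :=
  ContDiff ℝ ∞ φ ∧ HasCompactSupport φ ∧ tsupport φ ⊆ Ω

/-- `g` is the weak gradient of `u` in `Ω` (for `u`, `g` locally integrable in `Ω`). -/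
def IsWeakGradient (Ω : Set (EuclideanSpace ℝ (Fin m))) (u : EuclideanSpace ℝ (Fin m) → ℝ)
    (g : EuclideanSpace ℝ (Fin m) → EuclideanSpace ℝ (Fin m)) : Prop :=
  ∀ φ : EuclideanSpace ℝ (Fin m) → ℝ, IsTestFunction Ω φ →
    ∫ x in Ω, u x • gradient φ x = -∫ x in Ω, φ x • g x

/-- `u ∈ H¹(Ω)` with weak gradient `g`. Only the values on `Ω` matter. -/
def MemH1 (Ω : Set (EuclideanSpace ℝ (Fin m))) (u : EuclideanSpace ℝ (Fin m) → ℝ)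
    (g : EuclideanSpace ℝ (Fin m) → EuclideanSpace ℝ (Fin m)) : Prop :=
  MemLp u 2 (volume.restrict Ω) ∧ MemLp g 2 (volume.restrict Ω) ∧ IsWeakGradient Ω u g

/-- `u ∈ H₀¹(Ω)` with weak gradient `g`: `u` is in the closure of `C_c^∞(Ω)` in `H¹(Ω)`. -/
def MemH01 (Ω : Set (EuclideanSpace ℝ (Fin m))) (u : EuclideanSpace ℝ (Fin m) → ℝ)
    (g : EuclideanSpace ℝ (Fin m) → EuclideanSpace ℝ (Fin m)) : Prop :=
  MemH1 Ω u g ∧ ∃ φ : ℕ → EuclideanSpace ℝ (Fin m) → ℝ,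
    (∀ n, IsTestFunction Ω (φ n)) ∧
    Tendsto (fun n => eLpNorm (fun x => u x - φ n x) 2 (volume.restrict Ω)) atTop (𝓝 0) ∧
    Tendsto (fun n => eLpNorm (fun x => g x - gradient (φ n) x) 2 (volume.restrict Ω))
      atTop (𝓝 0)

/-- The bottom of the spectrum of the Dirichlet Laplacian: the infimum of the Rayleigh quotients
`∫ |Du|² / ∫ u²` over the non-zero `u ∈ H₀¹(Ω)`. -/
def lambda1 (Ω : Set (EuclideanSpace ℝ (Fin m))) : ℝ≥0∞ :=
  ⨅ (u : EuclideanSpace ℝ (Fin m) → ℝ)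
    (g : EuclideanSpace ℝ (Fin m) → EuclideanSpace ℝ (Fin m))
    (_ : MemH01 Ω u g) (_ : ¬ u =ᵐ[volume.restrict Ω] 0),
    (∫⁻ x in Ω, ‖g x‖ₑ ^ 2) / (∫⁻ x in Ω, ‖u x‖ₑ ^ 2)

/-- `v ∈ H₀¹(Ω)` and `-Δ v = 1` weakly in `Ω`. -/
def IsTorsionFunction (Ω : Set (EuclideanSpace ℝ (Fin m)))
    (v : EuclideanSpace ℝ (Fin m) → ℝ) : Prop :=
  ∃ g : EuclideanSpace ℝ (Fin m) → EuclideanSpace ℝ (Fin m), MemH01 Ω v g ∧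
    ∀ φ : EuclideanSpace ℝ (Fin m) → ℝ, IsTestFunction Ω φ →
      ∫ x in Ω, inner ℝ (g x) (gradient φ x) = ∫ x in Ω, φ x

open Classical in
/-- The torsion function `v_Ω`. For open `Ω` of finite measure the solution exists and is unique
almost everywhere in `Ω`; the value `0` is a default outside this range. -/
def torsionFunction (Ω : Set (EuclideanSpace ℝ (Fin m))) : EuclideanSpace ℝ (Fin m) → ℝ :=
  if h : ∃ v, IsTorsionFunction Ω v then h.choose else 0

/-- `T_p(Ω) = ‖v_Ω‖_{L^p(Ω)}`. -/
def T (p : ℝ) (Ω : Set (EuclideanSpace ℝ (Fin m))) : ℝ≥0∞ :=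
  eLpNorm (torsionFunction Ω) (ENNReal.ofReal p) (volume.restrict Ω)

/-- `F_p(Ω) = T_p(Ω) λ₁(Ω) / |Ω|^{1/p}`. -/
def F (p : ℝ) (Ω : Set (EuclideanSpace ℝ (Fin m))) : ℝ≥0∞ :=
  T p Ω * lambda1 Ω / volume Ω ^ (1 / p)

/-- The infimum of `F_p` over the open sets of positive finite measure in `ℝ^m`. -/
def G (m : ℕ) (p : ℝ) : ℝ≥0∞ :=
  ⨅ (Ω : Set (EuclideanSpace ℝ (Fin m))) (_ : IsOpen Ω)
    (_ : 0 < volume Ω) (_ : volume Ω < ⊤), F p Ω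

/-- The infimum of `F_p` over the open convex sets of positive finite measure in `ℝ^m`. -/
def GConvex (m : ℕ) (p : ℝ) : ℝ≥0∞ :=
  ⨅ (Ω : Set (EuclideanSpace ℝ (Fin m))) (_ : IsOpen Ω) (_ : Convex ℝ Ω)
    (_ : 0 < volume Ω) (_ : volume Ω < ⊤), F p Ω

end Torsion

end

noncomputable section

namespace Torsion

variable {m : ℕ}

/-! For (i), λ₁ is controlled by a fixed part of the set while the torsion function can be made
small on the rest. To a unit cube add a box of volume `n` cut into slabs of thickness `1 / n`. Any
test function of the cube bounds λ₁ by a constant `C`, whereas the torsion function is at most `1`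
over the cube and `1 / n` over the slabs. Hence F_p ≤ C (|Ω|^{-1/p} + 1/n), and |Ω| ≥ n.

For (ii), monotonicity is Hölder's inequality for the normalised measure on each Ω. The lower bound
rests on John's theorem: an ellipsoid E with semi-axes μᵢ^{-1/2} satisfies E ⊆ Ω ⊆ mE, where mE is
the concentric dilate. Three estimates follow. First, Ω lies in a box of half-widths m μᵢ^{-1/2}, so
λ₁(Ω) ≥ π²/(4m²) Σ μᵢ (`poincare_of_box`). Second, v_Ω dominates the torsion function of E, which is
(1 - Σ μᵢ yᵢ²)/(2 Σ μᵢ). Third, |Ω| ≤ m^m |E|. In the product Σ μᵢ and the Jacobian of E cancel, and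
what remains is the Beta integral of (1 - |x|²)^p over the unit ball.

All pointwise information on torsion functions comes from `comparison`, a weak comparison principle
with explicit smooth sub- and supersolutions. Existence is Lax-Milgram with coercivity from a
Poincaré inequality. John's theorem is proved by maximising the volume of inscribed ellipsoids: if
the unit ball were optimal and Ω had a point farther than `m` from the centre, stretching the ball
towards that point would enlarge it. -/

lemma MemLp.integrable_norm_sq {α F : Type*} [MeasurableSpace α] [NormedAddCommGroup F]
    {μ : Measure α} {f : α → F} (hf : MemLp f 2 μ) : Integrable (fun x => ‖f x‖ ^ 2) μ :=
  MeasureTheory.MemLp.integrable_norm_pow (p := 2) (by exact_mod_cast hf) (by norm_num)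

lemma integrable_of_continuousOn_compact {F : Type*} [NormedAddCommGroup F]
    {K : Set (EuclideanSpace ℝ (Fin m))} (hK : IsCompact K)
    {f : EuclideanSpace ℝ (Fin m) → F} (hf : ContinuousOn f K) (h0 : ∀ x ∉ K, f x = 0) :
    Integrable f := by
  rw [← integrableOn_iff_integrable_of_support_subset (s := K)]
  · exact hf.integrableOn_compact hK
  · intro x hx
    by_contra h
    exact hx (h0 x h)

/-- Integration by parts in the direction `v` against a compactly supported `φ`, with a function
`f` which is regular only on the support of `φ`. -/
lemma integral_mul_lineDeriv {φ f f' : EuclideanSpace ℝ (Fin m) → ℝ}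
    {v : EuclideanSpace ℝ (Fin m)} (hφ : ContDiff ℝ ∞ φ) (hc : HasCompactSupport φ)
    (hf : ContinuousOn f (tsupport φ)) (hf' : ContinuousOn f' (tsupport φ))
    (hd : ∀ x ∈ tsupport φ, HasLineDerivAt ℝ f (f' x) x v) :
    ∫ x, φ x * f' x = -∫ x, fderiv ℝ φ x v * f x := by
  have h0 : ∀ x ∉ tsupport φ, φ x = 0 := fun x hx => image_eq_zero_of_notMem_tsupport hx
  have h1 : ∀ x ∉ tsupport φ, fderiv ℝ φ x = 0 := fun x hx =>
    image_eq_zero_of_notMem_tsupport (fun h => hx (tsupport_fderiv_subset ℝ h))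
  have hφ' : Continuous fun x => fderiv ℝ φ x v := by
    have := hφ.continuous_fderiv (by simp)
    fun_prop
  refine integral_bilinear_hasLineDerivAt_right_eq_neg_left_of_integrable
    (B := ContinuousLinearMap.mul ℝ ℝ) (f := φ) (f' := fun x => fderiv ℝ φ x v) (v := v)
    ?_ ?_ ?_ (fun x _ => ?_) hd
  · exact integrable_of_continuousOn_compact hc (hφ'.continuousOn.mul hf)
      (fun x hx => by simp [h1 x hx])
  · exact integrable_of_continuousOn_compact hc (hφ.continuous.continuousOn.mul hf')
      (fun x hx => by simp [h0 x hx])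
  · exact integrable_of_continuousOn_compact hc (hφ.continuous.continuousOn.mul hf)
      (fun x hx => by simp [h0 x hx])
  · exact ((hφ.differentiable (by simp)) x).hasFDerivAt.hasLineDerivAt v

/-! ### Test functions and their gradients -/

namespace IsTestFunction

variable {Ω : Set (EuclideanSpace ℝ (Fin m))} {φ : EuclideanSpace ℝ (Fin m) → ℝ}

lemma continuous_gradient (h : IsTestFunction Ω φ) : Continuous (gradient φ) := by
  have := h.1.continuous_fderiv (by simp)
  unfold gradient
  fun_prop

lemma differentiable (h : IsTestFunction Ω φ) : Differentiable ℝ φ :=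
  h.1.differentiable (by simp)

lemma eq_zero (h : IsTestFunction Ω φ) {x : EuclideanSpace ℝ (Fin m)} (hx : x ∉ Ω) : φ x = 0 :=
  image_eq_zero_of_notMem_tsupport fun h' => hx (h.2.2 h')

lemma gradient_eq_zero_of_notMem (φ : EuclideanSpace ℝ (Fin m) → ℝ)
    {x : EuclideanSpace ℝ (Fin m)}
    (hx : x ∉ tsupport φ) : gradient φ x = 0 := by
  have : fderiv ℝ φ x = 0 :=
    image_eq_zero_of_notMem_tsupport (fun h' => hx (tsupport_fderiv_subset ℝ h'))
  simp [gradient, this]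

lemma gradient_eq_zero (h : IsTestFunction Ω φ) {x : EuclideanSpace ℝ (Fin m)} (hx : x ∉ Ω) :
    gradient φ x = 0 :=
  gradient_eq_zero_of_notMem φ fun h' => hx (h.2.2 h')

lemma hasCompactSupport_gradient (h : IsTestFunction Ω φ) : HasCompactSupport (gradient φ) :=
  HasCompactSupport.intro h.2.1 fun _ hx => gradient_eq_zero_of_notMem φ hx

lemma memLp (h : IsTestFunction Ω φ) : MemLp φ 2 volume :=
  h.1.continuous.memLp_of_hasCompactSupport h.2.1

lemma memLp_gradient (h : IsTestFunction Ω φ) : MemLp (gradient φ) 2 volume :=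
  h.continuous_gradient.memLp_of_hasCompactSupport h.hasCompactSupport_gradient

lemma setIntegral_eq {F : Type*} [NormedAddCommGroup F] [NormedSpace ℝ F]
    {f : EuclideanSpace ℝ (Fin m) → F} (h0 : ∀ x ∉ Ω, f x = 0) :
    ∫ x in Ω, f x = ∫ x, f x :=
  setIntegral_eq_integral_of_forall_compl_eq_zero h0

lemma isWeakGradient (h : IsTestFunction Ω φ) : IsWeakGradient Ω φ (gradient φ) := by
  intro ψ hψ
  have hi1 : Integrable (fun x => φ x • gradient ψ x) :=
    (h.1.continuous.smul hψ.continuous_gradient).integrable_of_hasCompactSupport h.2.1.smul_right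
  have hi2 : Integrable (fun x => ψ x • gradient φ x) :=
    (hψ.1.continuous.smul h.continuous_gradient).integrable_of_hasCompactSupport hψ.2.1.smul_right
  rw [setIntegral_eq (fun x hx => by simp [h.eq_zero hx]),
    setIntegral_eq (fun x hx => by simp [hψ.eq_zero hx])]
  refine ext_inner_left ℝ fun v => ?_
  rw [inner_neg_right, ← integral_inner hi1, ← integral_inner hi2]
  simp only [inner_smul_right, inner_gradient_right]
  have := integral_mul_lineDeriv (v := v) h.1 h.2.1 (hψ.1.continuous.continuousOn)
    (f' := fun x => fderiv ℝ ψ x v)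
    (by have := hψ.1.continuous_fderiv (by simp); fun_prop)
    (fun x _ => (hψ.differentiable x).hasFDerivAt.hasLineDerivAt v)
  simp only [conj_trivial]
  rw [this]
  simp [mul_comm]

lemma memH01 (h : IsTestFunction Ω φ) : MemH01 Ω φ (gradient φ) := by
  refine ⟨⟨h.memLp.restrict _, h.memLp_gradient.restrict _, h.isWeakGradient⟩, fun _ => φ,
    fun _ => h, ?_, ?_⟩ <;> simp

end IsTestFunction

/-! ### Poincaré inequalities and lower bounds for λ₁ -/

/-- One-dimensional Poincaré inequality in the direction `v`, for test functions in the slab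
`|⟪v, x - c⟫| < L`. -/
lemma slab_poincare {Ω : Set (EuclideanSpace ℝ (Fin m))} {φ : EuclideanSpace ℝ (Fin m) → ℝ}
    (h : IsTestFunction Ω φ) {v c : EuclideanSpace ℝ (Fin m)} (hv : ‖v‖ = 1) {L : ℝ} (hL : 0 < L)
    (hΩ : ∀ x ∈ Ω, |inner ℝ v (x - c)| < L) :
    (Real.pi / (2 * L)) ^ 2 * ∫ x, φ x ^ 2 ≤ ∫ x, (fderiv ℝ φ x v) ^ 2 := by
  set κ := Real.pi / (2 * L) with hκ
  have hκ0 : 0 < κ := by positivity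
  -- Ground state substitution: `-κ T` is the logarithmic derivative of `cos (κ ⟪v, x - c⟫)`, which
  -- is positive on the slab. The claim is the expansion of `0 ≤ ∫ (∂ᵥφ + κ φ T)²`, where the cross
  -- term is integrated by parts with `∂ᵥT = κ (1 + T²)`.
  set T : EuclideanSpace ℝ (Fin m) → ℝ := fun x => Real.tan (κ * inner ℝ v (x - c)) with hT
  have hcos : ∀ x ∈ tsupport φ, 0 < Real.cos (κ * inner ℝ v (x - c)) := by
    intro x hx
    have h1 := hΩ x (h.2.2 hx)
    rw [abs_lt] at h1
    have h2 : κ * L = Real.pi / 2 := by rw [hκ]; field_simp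
    apply Real.cos_pos_of_mem_Ioo
    constructor <;> nlinarith
  have hTc : ContinuousOn T (tsupport φ) := by
    intro x hx
    apply ContinuousAt.continuousWithinAt
    exact ContinuousAt.comp (f := fun x => κ * inner ℝ v (x - c)) (g := Real.tan)
      (Real.continuousAt_tan.2 (hcos x hx).ne') (by fun_prop)
  have hφ2 : tsupport (fun x => φ x ^ 2) ⊆ tsupport φ :=
    closure_mono fun x hx => by simpa using hx
  have hd : ∀ x ∈ tsupport φ, HasLineDerivAt ℝ T (κ * (1 + T x ^ 2)) x v := by
    intro x hx
    have h1 : HasDerivAt (fun t : ℝ => κ * inner ℝ v (x + t • v - c)) κ 0 := by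
      have : (fun t : ℝ => κ * inner ℝ v (x + t • v - c)) =
          fun t : ℝ => κ * inner ℝ v (x - c) + κ * t := by
        ext t
        have : x + t • v - c = (x - c) + t • v := by abel
        rw [this, inner_add_right, inner_smul_right, real_inner_self_eq_norm_sq, hv]
        ring
      rw [this]
      simpa using ((hasDerivAt_id (0 : ℝ)).const_mul κ).const_add (κ * inner ℝ v (x - c))
    have h2 : HasDerivAt Real.tan (1 / Real.cos (κ * inner ℝ v (x - c)) ^ 2)
        (κ * inner ℝ v (x + (0 : ℝ) • v - c)) := by
      simpa using Real.hasDerivAt_tan (hcos x hx).ne'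
    have h3 := h2.comp (0 : ℝ) h1
    have h4 : 1 / Real.cos (κ * inner ℝ v (x - c)) ^ 2 * κ = κ * (1 + T x ^ 2) := by
      rw [hT, mul_comm]
      simp only
      rw [Real.tan_eq_sin_div_cos]
      have := (hcos x hx).ne'
      field_simp
      linear_combination -(Real.sin_sq_add_cos_sq (κ * inner ℝ v (x - c)))
    rw [h4] at h3
    exact h3
  have hibp := integral_mul_lineDeriv (φ := fun x => φ x ^ 2) (f := T)
    (f' := fun x => κ * (1 + T x ^ 2)) (v := v) (h.1.pow 2)
    (HasCompactSupport.intro h.2.1 fun x hx => by simp [image_eq_zero_of_notMem_tsupport hx])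
    (hTc.mono hφ2)
    ((by fun_prop : ContinuousOn (fun x => κ * (1 + T x ^ 2)) (tsupport φ)).mono hφ2)
    (fun x hx => hd x (hφ2 hx))
  have hfd : ∀ x, fderiv ℝ (fun x => φ x ^ 2) x v = 2 * φ x * fderiv ℝ φ x v := by
    intro x
    rw [((h.differentiable x).hasFDerivAt.pow 2).fderiv]
    simp
  simp only [hfd] at hibp
  have h0 : ∀ x ∉ tsupport φ, φ x = 0 := fun x hx => image_eq_zero_of_notMem_tsupport hx
  have h1 : ∀ x ∉ tsupport φ, fderiv ℝ φ x = 0 := fun x hx =>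
    image_eq_zero_of_notMem_tsupport (fun h => hx (tsupport_fderiv_subset ℝ h))
  have hφc : ContinuousOn φ (tsupport φ) := h.1.continuous.continuousOn
  have hφ' : ContinuousOn (fun x => fderiv ℝ φ x v) (tsupport φ) := by
    have := h.1.continuous_fderiv (by simp)
    fun_prop
  have i1 : Integrable fun x => φ x ^ 2 * (κ * (1 + T x ^ 2)) :=
    integrable_of_continuousOn_compact h.2.1 (by fun_prop) (fun x hx => by simp [h0 x hx])
  have i2 : Integrable fun x => 2 * φ x * fderiv ℝ φ x v * T x :=
    integrable_of_continuousOn_compact h.2.1 (by fun_prop) (fun x hx => by simp [h0 x hx])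
  have i3 : Integrable fun x => φ x ^ 2 :=
    integrable_of_continuousOn_compact h.2.1 (by fun_prop) (fun x hx => by simp [h0 x hx])
  have i4 : Integrable fun x => (fderiv ℝ φ x v) ^ 2 :=
    integrable_of_continuousOn_compact h.2.1 (by fun_prop) (fun x hx => by simp [h1 x hx])
  have hpos : 0 ≤ ∫ x, (fderiv ℝ φ x v + κ * φ x * T x) ^ 2 := integral_nonneg fun x => sq_nonneg _
  have heq : ∫ x, (fderiv ℝ φ x v + κ * φ x * T x) ^ 2 =
      ∫ x, (((fderiv ℝ φ x v) ^ 2 - κ ^ 2 * φ x ^ 2) +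
        κ * (φ x ^ 2 * (κ * (1 + T x ^ 2)) + 2 * φ x * fderiv ℝ φ x v * T x)) := by
    congr 1
    ext x
    ring
  have i5 : Integrable fun x => (fderiv ℝ φ x v) ^ 2 - κ ^ 2 * φ x ^ 2 := i4.sub (i3.const_mul _)
  have i6 : Integrable fun x =>
      κ * (φ x ^ 2 * (κ * (1 + T x ^ 2)) + 2 * φ x * fderiv ℝ φ x v * T x) :=
    (i1.add i2).const_mul _
  rw [heq, integral_add i5 i6,
    integral_sub i4 (i3.const_mul _), integral_const_mul, integral_const_mul,
    integral_add i1 i2, hibp] at hpos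
  linarith

/-- The Poincaré inequality on `Ω` with constant `κ`. -/
def Poincare (Ω : Set (EuclideanSpace ℝ (Fin m))) (κ : ℝ) : Prop :=
  ∀ φ : EuclideanSpace ℝ (Fin m) → ℝ, IsTestFunction Ω φ →
    κ * ∫ x, φ x ^ 2 ≤ ∫ x, ‖gradient φ x‖ ^ 2

lemma integrable_fderiv_sq {Ω : Set (EuclideanSpace ℝ (Fin m))}
    {φ : EuclideanSpace ℝ (Fin m) → ℝ}
    (h : IsTestFunction Ω φ) (v : EuclideanSpace ℝ (Fin m)) :
    Integrable fun x => (fderiv ℝ φ x v) ^ 2 := by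
  have h1 : ∀ x ∉ tsupport φ, fderiv ℝ φ x = 0 := fun x hx =>
    image_eq_zero_of_notMem_tsupport (fun h => hx (tsupport_fderiv_subset ℝ h))
  have := h.1.continuous_fderiv (by simp)
  exact integrable_of_continuousOn_compact h.2.1 (by fun_prop) (fun x hx => by simp [h1 x hx])

/-- By Pythagoras for the gradient the slab inequalities of all basis directions add up. Keeping
every direction matters: the sum later cancels the trace `∑ μ i` in the torsion function of an
ellipsoid. -/
lemma poincare_of_box {Ω : Set (EuclideanSpace ℝ (Fin m))}
    (b : OrthonormalBasis (Fin m) ℝ (EuclideanSpace ℝ (Fin m))) {c : EuclideanSpace ℝ (Fin m)}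
    {L : Fin m → ℝ} (hL : ∀ i, 0 < L i) (hΩ : ∀ x ∈ Ω, ∀ i, |inner ℝ (b i) (x - c)| < L i) :
    Poincare Ω (∑ i, (Real.pi / (2 * L i)) ^ 2) := by
  intro φ h
  have h1 : ∀ x, ‖gradient φ x‖ ^ 2 = ∑ i, (fderiv ℝ φ x (b i)) ^ 2 := by
    intro x
    rw [← b.sum_sq_norm_inner_left (gradient φ x)]
    simp [inner_gradient_left]
  simp only [h1]
  rw [integral_finsetSum _ fun i _ => integrable_fderiv_sq h (b i), Finset.sum_mul]
  exact Finset.sum_le_sum fun i _ => slab_poincare h (b.norm_eq_one i) (hL i) fun x hx => hΩ x hx i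

lemma poincare_of_slab {Ω : Set (EuclideanSpace ℝ (Fin m))} {v c : EuclideanSpace ℝ (Fin m)}
    (hv : ‖v‖ = 1) {L : ℝ} (hL : 0 < L) (hΩ : ∀ x ∈ Ω, |inner ℝ v (x - c)| < L) :
    Poincare Ω ((Real.pi / (2 * L)) ^ 2) := by
  intro φ h
  refine (slab_poincare h hv hL hΩ).trans (integral_mono (integrable_fderiv_sq h v)
    (MemLp.integrable_norm_sq h.memLp_gradient) fun x => ?_)
  simp only
  rw [← inner_gradient_left, ← sq_abs]
  gcongr
  simpa [hv] using abs_real_inner_le_norm (gradient φ x) v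

lemma eLpNorm_two_sq {α F : Type*} [MeasurableSpace α] [NormedAddCommGroup F] (μ : Measure α)
    (f : α → F) : eLpNorm f 2 μ ^ 2 = ∫⁻ x, ‖f x‖ₑ ^ 2 ∂μ := by
  have := eLpNorm_nnreal_pow_eq_lintegral (f := f) (μ := μ) (p := 2) (by simp)
  simpa using this

lemma MemLp.eLpNorm_two_sq_eq {α F : Type*} [MeasurableSpace α] [NormedAddCommGroup F]
    {μ : Measure α} {f : α → F} (hf : MemLp f 2 μ) :
    eLpNorm f 2 μ ^ 2 = ENNReal.ofReal (∫ x, ‖f x‖ ^ 2 ∂μ) := by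
  rw [eLpNorm_two_sq, ofReal_integral_eq_lintegral_ofReal (MemLp.integrable_norm_sq hf)
    (ae_of_all _ fun x => by positivity)]
  refine lintegral_congr fun x => ?_
  rw [ENNReal.ofReal_pow (norm_nonneg _), ofReal_norm]

lemma Poincare.eLpNorm_le {Ω : Set (EuclideanSpace ℝ (Fin m))} {κ : ℝ} (hP : Poincare Ω κ)
    (hκ : 0 ≤ κ) {φ : EuclideanSpace ℝ (Fin m) → ℝ} (h : IsTestFunction Ω φ) :
    ENNReal.ofReal (Real.sqrt κ) * eLpNorm φ 2 (volume.restrict Ω) ≤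
      eLpNorm (gradient φ) 2 (volume.restrict Ω) := by
  rw [← ENNReal.pow_le_pow_left_iff (n := 2) (by norm_num), mul_pow,
    MemLp.eLpNorm_two_sq_eq (h.memLp.restrict _),
    MemLp.eLpNorm_two_sq_eq (h.memLp_gradient.restrict _), ← ENNReal.ofReal_pow (by positivity),
    Real.sq_sqrt hκ, ← ENNReal.ofReal_mul hκ]
  apply ENNReal.ofReal_le_ofReal
  rw [IsTestFunction.setIntegral_eq (fun x hx => by simp [h.eq_zero hx]),
    IsTestFunction.setIntegral_eq (fun x hx => by simp [h.gradient_eq_zero hx])]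
  simpa using hP φ h

/-- Both sides are continuous along the approximating test functions; the triangle inequality gives
the estimate with errors that tend to `0`. -/
lemma Poincare.eLpNorm_le_of_memH01 {Ω : Set (EuclideanSpace ℝ (Fin m))} {κ : ℝ}
    (hP : Poincare Ω κ) (hκ : 0 ≤ κ) {u : EuclideanSpace ℝ (Fin m) → ℝ}
    {g : EuclideanSpace ℝ (Fin m) → EuclideanSpace ℝ (Fin m)} (h : MemH01 Ω u g) :
    ENNReal.ofReal (Real.sqrt κ) * eLpNorm u 2 (volume.restrict Ω) ≤
      eLpNorm g 2 (volume.restrict Ω) := by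
  obtain ⟨⟨hu, hg, -⟩, φ, hφ, h1, h2⟩ := h
  set a := ENNReal.ofReal (Real.sqrt κ)
  have key : ∀ n, a * eLpNorm u 2 (volume.restrict Ω) ≤
      a * eLpNorm (fun x => u x - φ n x) 2 (volume.restrict Ω) +
        (eLpNorm g 2 (volume.restrict Ω) +
          eLpNorm (fun x => g x - gradient (φ n) x) 2 (volume.restrict Ω)) := by
    intro n
    have m1 := ((hφ n).memLp.restrict Ω)
    have m2 := ((hφ n).memLp_gradient.restrict Ω)
    have e1 : eLpNorm u 2 (volume.restrict Ω) ≤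
        eLpNorm (fun x => u x - φ n x) 2 (volume.restrict Ω) +
          eLpNorm (φ n) 2 (volume.restrict Ω) := by
      have := eLpNorm_add_le (hu.sub m1).1 m1.1 (p := 2) (by norm_num)
      simpa using! this
    have e2 : eLpNorm (gradient (φ n)) 2 (volume.restrict Ω) ≤ eLpNorm g 2 (volume.restrict Ω) +
        eLpNorm (fun x => g x - gradient (φ n) x) 2 (volume.restrict Ω) := by
      have := eLpNorm_sub_le hg.1 (hg.sub m2).1 (p := 2) (by norm_num)
      simpa using! this
    calc _ ≤ a * (_ + _) := mul_le_mul_right e1 a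
      _ = _ + _ := mul_add _ _ _
      _ ≤ _ := by
        gcongr
        exact (hP.eLpNorm_le hκ (hφ n)).trans e2
  have hlim := (ENNReal.Tendsto.const_mul (a := a) h1 (Or.inr ENNReal.ofReal_ne_top)).add
    ((tendsto_const_nhds (x := eLpNorm g 2 (volume.restrict Ω))).add h2)
  simpa using ge_of_tendsto' hlim key

lemma Poincare.le_lambda1 {Ω : Set (EuclideanSpace ℝ (Fin m))} {κ : ℝ}
    (hP : Poincare Ω κ) (hκ : 0 ≤ κ) : ENNReal.ofReal κ ≤ lambda1 Ω := by
  refine le_iInf fun u => le_iInf fun g => le_iInf fun h => le_iInf fun hu => ?_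
  rw [← eLpNorm_two_sq, ← eLpNorm_two_sq]
  have h0 : eLpNorm u 2 (volume.restrict Ω) ≠ 0 := fun h' =>
    hu ((eLpNorm_eq_zero_iff h.1.1.1 (by norm_num)).1 h')
  rw [ENNReal.le_div_iff_mul_le (Or.inl (pow_ne_zero _ h0))
    (Or.inl (ENNReal.pow_ne_top h.1.1.2.ne))]
  have := pow_le_pow_left' (hP.eLpNorm_le_of_memH01 hκ h) 2
  rwa [mul_pow, ← ENNReal.ofReal_pow (by positivity), Real.sq_sqrt hκ] at this

lemma integrable_inner_of_memLp {α F : Type*} [MeasurableSpace α] [NormedAddCommGroup F]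
    [InnerProductSpace ℝ F] {μ : Measure α} {f g : α → F} (hf : MemLp f 2 μ) (hg : MemLp g 2 μ) :
    Integrable (fun x => inner ℝ (f x) (g x)) μ := by
  refine (hf.norm.integrable_mul hg.norm).mono' (hf.1.inner hg.1) (ae_of_all _ fun x => ?_)
  exact abs_real_inner_le_norm _ _

/-- A smooth non-decreasing function which is positive exactly on `(ε, ∞)` and has bounded
derivative. -/
lemma exists_smooth_cutoff (ε : ℝ) : ∃ (h : ℝ → ℝ) (C : ℝ), 0 < C ∧ ContDiff ℝ ∞ h ∧
    (∀ t ≤ ε, h t = 0) ∧ (∀ t, ε < t → 0 < h t) ∧ (∀ t, 0 ≤ deriv h t) ∧ (∀ t, deriv h t ≤ C) ∧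
    ∀ s t, |h s - h t| ≤ C * |s - t| := by
  set h : ℝ → ℝ := fun t => Real.smoothTransition (t - ε) with hh
  have hs : ContDiff ℝ ∞ h := Real.smoothTransition.contDiff.comp (contDiff_id.sub contDiff_const)
  have hcs : HasCompactSupport (deriv h) := by
    refine HasCompactSupport.intro (isCompact_Icc (a := ε) (b := ε + 1)) fun t ht => ?_
    rw [Set.mem_Icc, not_and_or, not_le, not_le] at ht
    rcases ht with ht | ht
    · have : h =ᶠ[𝓝 t] fun _ => 0 := by
        filter_upwards [gt_mem_nhds ht] with s hs
        exact Real.smoothTransition.zero_of_nonpos (by linarith)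
      simp [this.deriv_eq]
    · have : h =ᶠ[𝓝 t] fun _ => 1 := by
        filter_upwards [lt_mem_nhds ht] with s hs
        exact Real.smoothTransition.one_of_one_le (by linarith)
      simp [this.deriv_eq]
  have hmono : Monotone h := fun s t hst => by
    apply Real.smoothTransition.monotone
    linarith
  obtain ⟨C, hC⟩ := (hs.continuous_deriv (by simp)).bounded_above_of_compact_support hcs
  -- The maximum with `1` makes the bound strictly positive.
  have hC1 : ∀ t, ‖deriv h t‖ ≤ max C 1 := fun t => (hC t).trans (le_max_left _ _)
  refine ⟨h, max C 1, by positivity, hs, fun t ht => ?_, fun t ht => ?_, fun t => ?_, fun t => ?_,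
    fun s t => ?_⟩
  · exact Real.smoothTransition.zero_of_nonpos (by linarith)
  · exact Real.smoothTransition.pos_of_pos (by linarith)
  · exact hmono.deriv_nonneg
  · exact (le_abs_self _).trans (hC1 t)
  · exact Convex.norm_image_sub_le_of_norm_deriv_le (s := Set.univ)
      (fun x _ => (hs.differentiable (by simp)) x) (fun x _ => hC1 x) convex_univ
      (Set.mem_univ t) (Set.mem_univ s)

/-! ### Weak comparison principle -/

section Comparison

variable {Ω : Set (EuclideanSpace ℝ (Fin m))} {f φ : EuclideanSpace ℝ (Fin m) → ℝ}
  {Gf : EuclideanSpace ℝ (Fin m) → EuclideanSpace ℝ (Fin m)} {σ ε : ℝ} {h : ℝ → ℝ}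

/-- Outside `tsupport φ ∪ K` the argument of `h` is `σ f < ε`, where `h` vanishes. The threshold `ε`
thus replaces any boundary condition on `f`. -/
lemma isTestFunction_cutoff_comp (hΩ : IsOpen Ω) (hφ : IsTestFunction Ω φ)
    (hf : ContDiffOn ℝ ∞ f Ω) {K : Set (EuclideanSpace ℝ (Fin m))} (hK : IsCompact K)
    (hKΩ : K ⊆ Ω) (hKf : ∀ x ∈ Ω, ε ≤ σ * f x → x ∈ K) (hs : ContDiff ℝ ∞ h)
    (h0 : ∀ t ≤ ε, h t = 0) :
    IsTestFunction Ω (Ω.indicator fun x => h (σ * (f x - φ x))) := by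
  have hS : IsCompact (tsupport φ ∪ K) := hφ.2.1.union hK
  have hz : ∀ x ∉ tsupport φ ∪ K, Ω.indicator (fun x => h (σ * (f x - φ x))) x = 0 := by
    intro x hx
    rw [Set.mem_union, not_or] at hx
    by_cases hxΩ : x ∈ Ω
    · rw [Set.indicator_of_mem hxΩ, image_eq_zero_of_notMem_tsupport hx.1]
      refine h0 _ (le_of_not_ge fun h' => hx.2 (hKf x hxΩ ?_))
      simpa using h'
    · exact Set.indicator_of_notMem hxΩ _
  refine ⟨contDiff_iff_contDiffAt.2 fun x => ?_, HasCompactSupport.intro hS hz, ?_⟩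
  · by_cases hxΩ : x ∈ Ω
    · have : Ω.indicator (fun x => h (σ * (f x - φ x))) =ᶠ[𝓝 x]
          fun x => h (σ * (f x - φ x)) := by
        filter_upwards [hΩ.mem_nhds hxΩ] with y hy
        exact Set.indicator_of_mem hy _
      refine ContDiffAt.congr_of_eventuallyEq ?_ this
      exact hs.contDiffAt.comp x
        (contDiffAt_const.mul ((hf.contDiffAt (hΩ.mem_nhds hxΩ)).sub hφ.1.contDiffAt))
    · have hxS : x ∉ tsupport φ ∪ K := fun h' =>
        hxΩ (Set.union_subset hφ.2.2 hKΩ h')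
      have : Ω.indicator (fun x => h (σ * (f x - φ x))) =ᶠ[𝓝 x] fun _ => 0 := by
        filter_upwards [hS.isClosed.isOpen_compl.mem_nhds hxS] with y hy
        exact hz y hy
      exact contDiffAt_const.congr_of_eventuallyEq this
  · refine (closure_minimal (fun x hx => ?_) hS.isClosed).trans (Set.union_subset hφ.2.2 hKΩ)
    by_contra h'
    exact hx (hz x h')

lemma gradient_cutoff_comp (hΩ : IsOpen Ω) (hφ : IsTestFunction Ω φ)
    (hG : ∀ x ∈ Ω, HasGradientAt f (Gf x) x) (hs : ContDiff ℝ ∞ h)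
    {x : EuclideanSpace ℝ (Fin m)} (hx : x ∈ Ω) :
    gradient (Ω.indicator fun x => h (σ * (f x - φ x))) x =
      (deriv h (σ * (f x - φ x)) * σ) • (Gf x - gradient φ x) := by
  have hev : Ω.indicator (fun x => h (σ * (f x - φ x))) =ᶠ[𝓝 x]
      fun x => h (σ * (f x - φ x)) := by
    filter_upwards [hΩ.mem_nhds hx] with y hy
    exact Set.indicator_of_mem hy _
  have h1 : HasFDerivAt (fun x => σ * (f x - φ x))
      (σ • ((InnerProductSpace.toDual ℝ _ (Gf x)) - fderiv ℝ φ x)) x :=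
    ((hG x hx).hasFDerivAt.sub (hφ.differentiable x).hasFDerivAt).const_mul σ
  have h2 : HasDerivAt h (deriv h (σ * (f x - φ x))) (σ * (f x - φ x)) :=
    ((hs.differentiable (by simp)) _).hasDerivAt
  have h3 := (h2.comp_hasFDerivAt x h1).congr_of_eventuallyEq hev
  refine HasGradientAt.gradient ?_
  rw [hasGradientAt_iff_hasFDerivAt]
  rw [smul_smul] at h3
  rwa [map_smul, map_sub, toDual_gradient]

/-- Energy estimate for the test function `h (σ (f - φ))`. -/
lemma eLpNorm_gradient_cutoff_le (hΩ : IsOpen Ω) (hφ : IsTestFunction Ω φ)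
    {g : EuclideanSpace ℝ (Fin m) → EuclideanSpace ℝ (Fin m)} (hg : MemLp g 2 (volume.restrict Ω))
    (hσ : σ ^ 2 = 1) (hG : ∀ x ∈ Ω, HasGradientAt f (Gf x) x) (hGc : ContinuousOn Gf Ω)
    (hs : ContDiff ℝ ∞ h) {C : ℝ} (hC : 0 < C) (hd0 : ∀ t, 0 ≤ deriv h t)
    (hd1 : ∀ t, deriv h t ≤ C)
    (hψ : IsTestFunction Ω (Ω.indicator fun x => h (σ * (f x - φ x))))
    (hle : σ * ∫ x in Ω, inner ℝ (Gf x)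
        (gradient (Ω.indicator fun x => h (σ * (f x - φ x))) x) ≤
      σ * ∫ x in Ω, inner ℝ (g x) (gradient (Ω.indicator fun x => h (σ * (f x - φ x))) x)) :
    eLpNorm (gradient (Ω.indicator fun x => h (σ * (f x - φ x)))) 2 (volume.restrict Ω) ≤
      ENNReal.ofReal C * eLpNorm (fun x => g x - gradient φ x) 2 (volume.restrict Ω) := by
  have hgrad := fun x (hx : x ∈ Ω) => gradient_cutoff_comp (σ := σ) hΩ hφ hG hs hx
  set ψ := Ω.indicator fun x => h (σ * (f x - φ x)) with hψdef
  have hdm : MemLp (fun x => g x - gradient φ x) 2 (volume.restrict Ω) :=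
    hg.sub (hφ.memLp_gradient.restrict _)
  have hPm : MemLp (gradient ψ) 2 (volume.restrict Ω) := hψ.memLp_gradient.restrict _
  have i1 : Integrable (fun x => inner ℝ (Gf x) (gradient ψ x)) := by
    refine integrable_of_continuousOn_compact hψ.2.1 ?_ fun x hx => by
      rw [IsTestFunction.gradient_eq_zero_of_notMem ψ hx, inner_zero_right]
    exact (hGc.mono hψ.2.2).inner hψ.continuous_gradient.continuousOn
  have i2 : Integrable (fun x => inner ℝ (g x) (gradient ψ x)) (volume.restrict Ω) :=
    integrable_inner_of_memLp hg hPm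
  -- With `H = h'`, `D = Gf - ∇φ` and `d = g - ∇φ`, the pointwise inequality is `H²|D|² - C²|d|² ≤
  -- 2CH(|D|² - ⟪d, D⟫)`. It follows from `2CH|d||D| ≤ C²|d|² + H²|D|²` and `0 ≤ H ≤ C`. The
  -- integral of the right side is nonpositive by `hle`.
  have key : ∫ x in Ω, (‖gradient ψ x‖ ^ 2 - C ^ 2 * ‖g x - gradient φ x‖ ^ 2) ≤
      ∫ x in Ω, 2 * C * (σ * inner ℝ (Gf x) (gradient ψ x) - σ * inner ℝ (g x) (gradient ψ x)) := by
    refine setIntegral_mono_on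
      ((MemLp.integrable_norm_sq hPm).sub ((MemLp.integrable_norm_sq hdm).const_mul _))
      (((i1.restrict.const_mul σ).sub (i2.const_mul σ)).const_mul _) hΩ.measurableSet
      fun x hx => ?_
    rw [hgrad x hx]
    set H := deriv h (σ * (f x - φ x))
    set D := Gf x - gradient φ x with hD
    set d := g x - gradient φ x with hd
    have e1 : Gf x = g x + (D - d) := by rw [hD, hd]; abel
    have e2 : σ * inner ℝ (Gf x) ((H * σ) • D) - σ * inner ℝ (g x) ((H * σ) • D) =
        H * (‖D‖ ^ 2 - inner ℝ d D) := by
      rw [e1, inner_add_left, inner_smul_right, inner_smul_right, inner_sub_left,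
        real_inner_self_eq_norm_sq]
      linear_combination (H * (‖D‖ ^ 2 - inner ℝ d D)) * hσ
    have e3 : ‖(H * σ) • D‖ ^ 2 = H ^ 2 * ‖D‖ ^ 2 := by
      rw [norm_smul, mul_pow, Real.norm_eq_abs, sq_abs, mul_pow, hσ, mul_one]
    rw [e2, e3]
    have hH0 : 0 ≤ H := hd0 _
    have hH1 : H ≤ C := hd1 _
    have hCS : inner ℝ d D ≤ ‖d‖ * ‖D‖ := real_inner_le_norm d D
    have hCS' : H * inner ℝ d D ≤ H * (‖d‖ * ‖D‖) := mul_le_mul_of_nonneg_left hCS hH0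
    nlinarith [sq_nonneg (C * ‖d‖ - H * ‖D‖), mul_nonneg hH0 (sub_nonneg.2 hH1),
      mul_nonneg (mul_nonneg hH0 (sub_nonneg.2 hH1)) (sq_nonneg ‖D‖)]
  rw [integral_const_mul, integral_sub (i1.restrict.const_mul σ) (i2.const_mul σ),
    integral_const_mul, integral_const_mul,
    integral_sub (MemLp.integrable_norm_sq hPm) ((MemLp.integrable_norm_sq hdm).const_mul _),
    integral_const_mul] at key
  rw [← ENNReal.pow_le_pow_left_iff (n := 2) (by norm_num), mul_pow,
    MemLp.eLpNorm_two_sq_eq hPm, MemLp.eLpNorm_two_sq_eq hdm, ← ENNReal.ofReal_pow hC.le,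
    ← ENNReal.ofReal_mul (by positivity)]
  apply ENNReal.ofReal_le_ofReal
  nlinarith [mul_nonneg (mul_nonneg zero_le_two hC.le) (sub_nonneg.2 hle)]

/-- Weak comparison principle. With `σ = 1` the function `f` is a subsolution and lies below the
torsion function, with `σ = -1` it is a supersolution and lies above. -/
theorem comparison (hΩ : IsOpen Ω) {κ : ℝ} (hκ : 0 < κ) (hP : Poincare Ω κ)
    {v : EuclideanSpace ℝ (Fin m) → ℝ} (hv : IsTorsionFunction Ω v) (hσ : σ ^ 2 = 1)
    (hf : ContDiffOn ℝ ∞ f Ω) (hG : ∀ x ∈ Ω, HasGradientAt f (Gf x) x)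
    (hK : ∀ ε > 0, ∃ K, IsCompact K ∧ K ⊆ Ω ∧ ∀ x ∈ Ω, ε ≤ σ * f x → x ∈ K)
    (hsub : ∀ ψ, IsTestFunction Ω ψ → (∀ x, 0 ≤ ψ x) →
      σ * ∫ x in Ω, inner ℝ (Gf x) (gradient ψ x) ≤ σ * ∫ x in Ω, ψ x) :
    ∀ᵐ x ∂volume.restrict Ω, σ * f x ≤ σ * v x := by
  obtain ⟨g, ⟨⟨hvm, hgm, -⟩, φ, hφ, hφ1, hφ2⟩, hweak⟩ := hv
  have hGc : ContinuousOn Gf Ω := by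
    have h1 : ContinuousOn (fun x => (InnerProductSpace.toDual ℝ _).symm (fderiv ℝ f x)) Ω :=
      (LinearIsometryEquiv.continuous _).comp_continuousOn
        (hf.continuousOn_fderiv_of_isOpen hΩ (by simp))
    exact h1.congr fun x hx => (hG x hx).gradient.symm
  -- Working above a level `ε` gives the cutoffs compact support in `Ω`; the levels `1 / (n + 1)`
  -- then tend to `0`.
  have main : ∀ ε > 0, ∀ᵐ x ∂volume.restrict Ω, σ * (f x - v x) ≤ ε := by
    intro ε hε
    obtain ⟨K, hKc, hKΩ, hKf⟩ := hK ε hε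
    obtain ⟨h, C, hC, hs, h0, hpos, hd0, hd1, hlip⟩ := exists_smooth_cutoff ε
    have hnn : ∀ t, 0 ≤ h t := fun t => by
      rcases le_or_gt t ε with ht | ht
      · exact (h0 t ht).ge
      · exact (hpos t ht).le
    -- The natural test function is `h (σ (f - v))`, but `v` is only in `H₀¹`. Replacing `v` by `φ
    -- n` gives genuine test functions; their gradients tend to `0` in `L²`, so by Poincaré the
    -- limit `k` is zero.
    set ψ : ℕ → EuclideanSpace ℝ (Fin m) → ℝ :=
      fun n => Ω.indicator fun x => h (σ * (f x - φ n x)) with hψ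
    have hψt : ∀ n, IsTestFunction Ω (ψ n) := fun n =>
      isTestFunction_cutoff_comp hΩ (hφ n) hf hKc hKΩ hKf hs h0
    have hgr : ∀ n, eLpNorm (gradient (ψ n)) 2 (volume.restrict Ω) ≤
        ENNReal.ofReal C * eLpNorm (fun x => g x - gradient (φ n) x) 2 (volume.restrict Ω) := by
      intro n
      refine eLpNorm_gradient_cutoff_le hΩ (hφ n) hgm hσ hG hGc hs hC hd0 hd1 (hψt n) ?_
      refine (hsub _ (hψt n) fun x => Set.indicator_nonneg (fun x _ => hnn _) x).trans_eq ?_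
      rw [hweak _ (hψt n)]
    have hfm : AEStronglyMeasurable f (volume.restrict Ω) :=
      hf.continuousOn.aestronglyMeasurable hΩ.measurableSet
    set k : EuclideanSpace ℝ (Fin m) → ℝ := fun x => h (σ * (f x - v x)) with hk
    have hkm : AEStronglyMeasurable k (volume.restrict Ω) :=
      hs.continuous.comp_aestronglyMeasurable ((hfm.sub hvm.1).const_mul σ)
    have hσa : |σ| = 1 := by
      rw [← sq_abs] at hσ
      exact (pow_eq_one_iff_of_nonneg (abs_nonneg _) two_ne_zero).1 hσ
    set a := ENNReal.ofReal (Real.sqrt κ) with ha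
    have hk1 : ∀ n, eLpNorm k 2 (volume.restrict Ω) ≤
        eLpNorm (ψ n) 2 (volume.restrict Ω) +
          ENNReal.ofReal C * eLpNorm (fun x => v x - φ n x) 2 (volume.restrict Ω) := by
      intro n
      have hkψ : eLpNorm (fun x => k x - ψ n x) 2 (volume.restrict Ω) ≤
          ENNReal.ofReal C * eLpNorm (fun x => v x - φ n x) 2 (volume.restrict Ω) := by
        refine eLpNorm_le_mul_eLpNorm_of_ae_le_mul ?_ 2
        filter_upwards [ae_restrict_mem hΩ.measurableSet] with x hx
        simp only [hψ, hk, Set.indicator_of_mem hx, Real.norm_eq_abs]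
        refine (hlip _ _).trans_eq ?_
        have : σ * (f x - v x) - σ * (f x - φ n x) = -(σ * (v x - φ n x)) := by ring
        rw [this, abs_neg, abs_mul, hσa, one_mul]
      have := eLpNorm_add_le (p := 2) ((hψt n).memLp.restrict Ω).1
        (hkm.sub ((hψt n).memLp.restrict Ω).1) (by norm_num)
      rw [add_sub_cancel] at this
      exact this.trans (add_le_add le_rfl hkψ)
    have hk2 : ∀ n, a * eLpNorm k 2 (volume.restrict Ω) ≤
        ENNReal.ofReal C * eLpNorm (fun x => g x - gradient (φ n) x) 2 (volume.restrict Ω) +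
          a * (ENNReal.ofReal C * eLpNorm (fun x => v x - φ n x) 2 (volume.restrict Ω)) := by
      intro n
      calc _ ≤ a * _ := mul_le_mul_right (hk1 n) a
        _ = _ := mul_add _ _ _
        _ ≤ _ := add_le_add ((hP.eLpNorm_le hκ.le (hψt n)).trans (hgr n)) le_rfl
    have hlim := (ENNReal.Tendsto.const_mul (a := ENNReal.ofReal C) hφ2
      (Or.inr ENNReal.ofReal_ne_top)).add (ENNReal.Tendsto.const_mul (a := a)
        (ENNReal.Tendsto.const_mul (a := ENNReal.ofReal C) hφ1 (Or.inr ENNReal.ofReal_ne_top))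
        (Or.inr ENNReal.ofReal_ne_top))
    have hk3 := ge_of_tendsto' hlim hk2
    simp only [mul_zero, add_zero, nonpos_iff_eq_zero, mul_eq_zero] at hk3
    have ha0 : a ≠ 0 := by simpa [ha] using hκ
    have hk4 := (eLpNorm_eq_zero_iff hkm (by norm_num)).1 (hk3.resolve_left ha0)
    filter_upwards [hk4] with x hx
    by_contra h'
    exact (hpos _ (not_le.1 h')).ne' hx
  have hall : ∀ᵐ x ∂volume.restrict Ω, ∀ n : ℕ, σ * (f x - v x) ≤ 1 / ((n : ℝ) + 1) :=
    ae_all_iff.2 fun n => main _ (by positivity)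
  filter_upwards [hall] with x hx
  have := ge_of_tendsto' tendsto_one_div_add_atTop_nhds_zero_nat hx
  linarith

end Comparison

/-! ### Existence of the torsion function -/

section Existence

namespace IsTestFunction

variable {Ω : Set (EuclideanSpace ℝ (Fin m))} {φ ψ : EuclideanSpace ℝ (Fin m) → ℝ}

protected lemma zero : IsTestFunction Ω (0 : EuclideanSpace ℝ (Fin m) → ℝ) := by
  refine ⟨contDiff_const, HasCompactSupport.zero, ?_⟩
  simp [tsupport]

protected lemma add (hφ : IsTestFunction Ω φ) (hψ : IsTestFunction Ω ψ) :
    IsTestFunction Ω (φ + ψ) :=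
  ⟨hφ.1.add hψ.1, hφ.2.1.add hψ.2.1,
    (tsupport_add φ ψ).trans (Set.union_subset hφ.2.2 hψ.2.2)⟩

protected lemma smul (c : ℝ) (hφ : IsTestFunction Ω φ) : IsTestFunction Ω (c • φ) :=
  ⟨hφ.1.const_smul c, hφ.2.1.smul_left (f := fun _ => c),
    (closure_mono (Function.support_const_smul_subset c φ)).trans hφ.2.2⟩

lemma gradient_add (hφ : IsTestFunction Ω φ) (hψ : IsTestFunction Ω ψ) :
    gradient (φ + ψ) = gradient φ + gradient ψ := by
  ext1 x
  simp [gradient, fderiv_add (hφ.differentiable x) (hψ.differentiable x)]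

lemma gradient_smul (c : ℝ) (hφ : IsTestFunction Ω φ) :
    gradient (c • φ) = c • gradient φ := by
  ext1 x
  simp [gradient, fderiv_const_smul (hφ.differentiable x)]

end IsTestFunction

/-- The ambient Hilbert space `L²(Ω) × L²(Ω; ℝᵐ)` of `H¹(Ω)`. -/
abbrev L2Pair (Ω : Set (EuclideanSpace ℝ (Fin m))) : Type :=
  WithLp 2 (Lp ℝ 2 (volume.restrict Ω) × Lp (EuclideanSpace ℝ (Fin m)) 2 (volume.restrict Ω))

/-- The pairs `(φ, ∇φ)` with `φ ∈ C_c^∞(Ω)`. -/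
def testPairs (Ω : Set (EuclideanSpace ℝ (Fin m))) : Submodule ℝ (L2Pair Ω) where
  carrier := {z | ∃ φ, IsTestFunction Ω φ ∧ z.fst =ᵐ[volume.restrict Ω] φ ∧
    z.snd =ᵐ[volume.restrict Ω] gradient φ}
  zero_mem' := by
    refine ⟨0, IsTestFunction.zero, Lp.coeFn_zero _ _ _, ?_⟩
    refine (Lp.coeFn_zero _ _ _).trans (ae_of_all _ fun x => ?_)
    simp [gradient]
  add_mem' := by
    rintro z w ⟨φ, hφ, h1, h2⟩ ⟨ψ, hψ, h3, h4⟩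
    refine ⟨φ + ψ, hφ.add hψ, (Lp.coeFn_add _ _).trans (h1.add h3), ?_⟩
    rw [hφ.gradient_add hψ]
    exact (Lp.coeFn_add _ _).trans (h2.add h4)
  smul_mem' := by
    rintro c z ⟨φ, hφ, h1, h2⟩
    refine ⟨c • φ, hφ.smul c, (Lp.coeFn_smul _ _).trans (h1.const_smul c), ?_⟩
    rw [hφ.gradient_smul c]
    exact (Lp.coeFn_smul _ _).trans (h2.const_smul c)

variable {Ω : Set (EuclideanSpace ℝ (Fin m))}

/-- The element of `testPairs` given by a test function. -/
def IsTestFunction.toPair {φ : EuclideanSpace ℝ (Fin m) → ℝ} (h : IsTestFunction Ω φ) :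
    L2Pair Ω :=
  WithLp.toLp 2 ((h.memLp.restrict Ω).toLp φ, (h.memLp_gradient.restrict Ω).toLp (gradient φ))

lemma IsTestFunction.toPair_mem {φ : EuclideanSpace ℝ (Fin m) → ℝ} (h : IsTestFunction Ω φ) :
    h.toPair ∈ testPairs Ω :=
  ⟨φ, h, (h.memLp.restrict Ω).coeFn_toLp, (h.memLp_gradient.restrict Ω).coeFn_toLp⟩

/-- Tested against fixed `ψ` and `e`, the weak gradient identity says that a continuous linear
functional of the pair vanishes. This holds on test pairs by integration by parts, hence on their
closure. -/
lemma memH01_of_mem_closure {z : L2Pair Ω} (hz : z ∈ (testPairs Ω).topologicalClosure) :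
    MemH01 Ω z.fst z.snd := by
  refine ⟨⟨Lp.memLp _, Lp.memLp _, fun ψ hψ => ?_⟩, ?_⟩
  · refine ext_inner_left ℝ fun e => ?_
    have m1 : MemLp (fun x => inner ℝ e (gradient ψ x)) 2 (volume.restrict Ω) :=
      (hψ.memLp_gradient.restrict Ω).const_inner e
    have m2 : MemLp (fun x => ψ x • e) 2 (volume.restrict Ω) := by
      have hc : Continuous fun x => ψ x • e := hψ.1.continuous.smul continuous_const
      exact (hc.memLp_of_hasCompactSupport hψ.2.1.smul_right).restrict Ω
    have hrep : ∀ w : L2Pair Ω, inner ℝ (m1.toLp _) w.fst + inner ℝ (m2.toLp _) w.snd =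
        inner ℝ e (∫ x in Ω, w.fst x • gradient ψ x) + inner ℝ e (∫ x in Ω, ψ x • w.snd x) := by
      intro w
      have j1 : Integrable (fun x => w.fst x • gradient ψ x) (volume.restrict Ω) :=
        memLp_one_iff_integrable.1 ((hψ.memLp_gradient.restrict Ω).smul (Lp.memLp w.fst))
      have j2 : Integrable (fun x => ψ x • w.snd x) (volume.restrict Ω) :=
        memLp_one_iff_integrable.1 ((Lp.memLp w.snd).smul (hψ.memLp.restrict Ω))
      rw [L2.inner_def, L2.inner_def, ← integral_inner j1, ← integral_inner j2]
      congr 1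
      · refine integral_congr_ae ?_
        filter_upwards [m1.coeFn_toLp] with x hx
        rw [hx, inner_smul_right]
        simp
      · refine integral_congr_ae ?_
        filter_upwards [m2.coeFn_toLp] with x hx
        rw [hx, inner_smul_left, inner_smul_right]
        simp
    have hcl : IsClosed {w : L2Pair Ω |
        inner ℝ (m1.toLp _) w.fst + inner ℝ (m2.toLp _) w.snd = 0} := by
      refine isClosed_eq ?_ continuous_const
      exact (continuous_const.inner (WithLp.fstL 2 ℝ _ _).continuous).add
        (continuous_const.inner (WithLp.sndL 2 ℝ _ _).continuous)
    have hsub : (testPairs Ω : Set (L2Pair Ω)) ⊆ {w : L2Pair Ω |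
        inner ℝ (m1.toLp _) w.fst + inner ℝ (m2.toLp _) w.snd = 0} := by
      rintro w ⟨φ, hφ, h1, h2⟩
      simp only [Set.mem_ofPred_eq]
      have e1 : ∫ x in Ω, w.fst x • gradient ψ x = ∫ x in Ω, φ x • gradient ψ x :=
        integral_congr_ae (by filter_upwards [h1] with x hx; rw [hx])
      have e2 : ∫ x in Ω, ψ x • w.snd x = ∫ x in Ω, ψ x • gradient φ x :=
        integral_congr_ae (by filter_upwards [h2] with x hx; rw [hx])
      rw [hrep, e1, e2, hφ.isWeakGradient ψ hψ]
      simp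
    have := closure_minimal hsub hcl hz
    simp only [Set.mem_ofPred_eq, hrep] at this
    rw [inner_neg_right]
    linarith
  · obtain ⟨w, hw, hlim⟩ := mem_closure_iff_seq_limit.1 hz
    choose φ hφ h1 h2 using hw
    refine ⟨φ, hφ, ?_, ?_⟩
    · have h3 : Tendsto (fun n => (z - w n).fst) atTop (𝓝 0) := by
        have := ((WithLp.fstL 2 ℝ (Lp ℝ 2 (volume.restrict Ω))
          (Lp (EuclideanSpace ℝ (Fin m)) 2 (volume.restrict Ω))).continuous.tendsto _).comp
          ((tendsto_const_nhds (x := z)).sub hlim)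
        simpa using! this
      have h4 := h3.enorm
      simp only [enorm_zero] at h4
      refine h4.congr fun n => ?_
      rw [Lp.enorm_def]
      refine eLpNorm_congr_ae ?_
      filter_upwards [Lp.coeFn_sub z.fst (w n).fst, h1 n] with x hx hx1
      rw [← hx1]
      exact hx
    · have h3 : Tendsto (fun n => (z - w n).snd) atTop (𝓝 0) := by
        have := ((WithLp.sndL 2 ℝ (Lp ℝ 2 (volume.restrict Ω))
          (Lp (EuclideanSpace ℝ (Fin m)) 2 (volume.restrict Ω))).continuous.tendsto _).comp
          ((tendsto_const_nhds (x := z)).sub hlim)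
        simpa using! this
      have h4 := h3.enorm
      simp only [enorm_zero] at h4
      refine h4.congr fun n => ?_
      rw [Lp.enorm_def]
      refine eLpNorm_congr_ae ?_
      filter_upwards [Lp.coeFn_sub z.snd (w n).snd, h2 n] with x hx hx1
      rw [← hx1]
      exact hx

lemma Poincare.norm_fst_le {κ : ℝ} (hP : Poincare Ω κ) (hκ : 0 < κ) {z : L2Pair Ω}
    (hz : z ∈ (testPairs Ω).topologicalClosure) : κ * ‖z.fst‖ ^ 2 ≤ ‖z.snd‖ ^ 2 := by
  have := ENNReal.toReal_mono (Lp.eLpNorm_ne_top _)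
    (hP.eLpNorm_le_of_memH01 hκ.le (memH01_of_mem_closure hz))
  rw [ENNReal.toReal_mul, ENNReal.toReal_ofReal (by positivity), ← Lp.norm_def, ← Lp.norm_def]
    at this
  have h2 := pow_le_pow_left₀ (by positivity) this 2
  rwa [mul_pow, Real.sq_sqrt hκ.le] at h2

/-- A form of the Lax-Milgram theorem on the closure of a subspace of a product. -/
lemma exists_inner_snd_eq_inner_fst {H₁ H₂ : Type*} [NormedAddCommGroup H₁]
    [InnerProductSpace ℝ H₁] [CompleteSpace H₁] [NormedAddCommGroup H₂] [InnerProductSpace ℝ H₂]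
    [CompleteSpace H₂] (S : Submodule ℝ (WithLp 2 (H₁ × H₂))) {κ : ℝ} (hκ : 0 < κ)
    (hS : ∀ z ∈ S.topologicalClosure, κ * ‖z.fst‖ ^ 2 ≤ ‖z.snd‖ ^ 2) (a : H₁) :
    ∃ z ∈ S.topologicalClosure, ∀ w ∈ S, inner ℝ z.snd w.snd = inner ℝ a w.fst := by
  set K := S.topologicalClosure with hK
  have : CompleteSpace K := S.isClosed_topologicalClosure.completeSpace_coe
  set P : K →L[ℝ] H₂ := (WithLp.sndL 2 ℝ H₁ H₂).comp K.subtypeL with hPdef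
  set Q : K →L[ℝ] H₁ := (WithLp.fstL 2 ℝ H₁ H₂).comp K.subtypeL with hQdef
  set B : K →L[ℝ] K →L[ℝ] ℝ := (innerSL ℝ).bilinearComp P P with hB
  have hBapp : ∀ z w : K, B z w = inner ℝ z.1.snd w.1.snd := fun z w => rfl
  have hco : IsCoercive B := by
    -- By Poincaré, `‖z‖² = ‖z.fst‖² + ‖z.snd‖² ≤ (κ⁻¹ + 1) ‖z.snd‖²`.
    refine ⟨(1 + κ⁻¹)⁻¹, by positivity, fun z => ?_⟩
    rw [hBapp, real_inner_self_eq_norm_sq]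
    have h1 := hS z z.2
    have h2 : ‖z‖ ^ 2 = ‖z.1.fst‖ ^ 2 + ‖z.1.snd‖ ^ 2 :=
      WithLp.prod_norm_sq_eq_of_L2 z.1
    rw [mul_assoc, ← sq, inv_mul_le_iff₀ (by positivity), h2, add_mul, one_mul]
    have : ‖z.1.fst‖ ^ 2 ≤ κ⁻¹ * ‖z.1.snd‖ ^ 2 := by
      rw [le_inv_mul_iff₀ hκ]
      exact h1
    linarith
  set ℓ : K →L[ℝ] ℝ := (innerSL ℝ a).comp Q with hℓ
  set f₀ : K := (InnerProductSpace.toDual ℝ K).symm ℓ with hf₀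
  set z : K := hco.continuousLinearEquivOfBilin.symm f₀ with hz
  refine ⟨z, z.2, fun w hw => ?_⟩
  have h1 : B z ⟨w, S.le_topologicalClosure hw⟩ = ℓ ⟨w, S.le_topologicalClosure hw⟩ := by
    rw [← hco.continuousLinearEquivOfBilin_apply, hz, ContinuousLinearEquiv.apply_symm_apply, hf₀,
      InnerProductSpace.toDual_symm_apply]
  exact h1

/-- Existence of the torsion function when a Poincaré inequality holds. -/
theorem exists_isTorsionFunction (hfin : volume Ω < ⊤) {κ : ℝ} (hκ : 0 < κ)
    (hP : Poincare Ω κ) : ∃ v, IsTorsionFunction Ω v := by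
  have : IsFiniteMeasure (volume.restrict Ω) := ⟨by simpa using hfin⟩
  have mone : MemLp (fun _ : EuclideanSpace ℝ (Fin m) => (1 : ℝ)) 2 (volume.restrict Ω) :=
    memLp_const 1
  obtain ⟨z, hz, hsol⟩ := exists_inner_snd_eq_inner_fst (testPairs Ω) hκ
    (fun z hz => hP.norm_fst_le hκ hz) (mone.toLp _)
  refine ⟨_, _, memH01_of_mem_closure hz, fun φ hφ => ?_⟩
  have h1 := hsol _ hφ.toPair_mem
  have h2 : hφ.toPair.fst = (hφ.memLp.restrict Ω).toLp φ := rfl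
  have h3 : hφ.toPair.snd = (hφ.memLp_gradient.restrict Ω).toLp (gradient φ) := rfl
  rw [h2, h3, L2.inner_def, L2.inner_def] at h1
  rw [integral_congr_ae (g := fun x => inner ℝ (z.snd x)
    (((hφ.memLp_gradient.restrict Ω).toLp (gradient φ)) x)), h1]
  · refine integral_congr_ae ?_
    filter_upwards [mone.coeFn_toLp, (hφ.memLp.restrict Ω).coeFn_toLp] with x hx hx1
    rw [hx, hx1]
    simp
  · filter_upwards [(hφ.memLp_gradient.restrict Ω).coeFn_toLp] with x hx
    rw [hx]

lemma torsionFunction_spec (h : ∃ v, IsTorsionFunction Ω v) :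
    IsTorsionFunction Ω (torsionFunction Ω) := by
  rw [torsionFunction, dif_pos h]
  exact h.choose_spec

lemma aestronglyMeasurable_torsionFunction (Ω : Set (EuclideanSpace ℝ (Fin m))) :
    AEStronglyMeasurable (torsionFunction Ω) (volume.restrict Ω) := by
  by_cases h : ∃ v, IsTorsionFunction Ω v
  · obtain ⟨g, hg, -⟩ := torsionFunction_spec h
    exact hg.1.1.1
  · rw [torsionFunction, dif_neg h]
    exact aestronglyMeasurable_const

end Existence

/-! ### Slit cylinders and the vanishing of the infimum over open sets -/

section UnboundedFamily

/-- The unit interval together with `(-n, 0)` cut at the multiples of `1 / n`. -/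
def slitLine (n : ℕ) : Set ℝ :=
  Set.Ioo 0 1 ∪ (Set.Ioo (-n : ℝ) 0 ∩ (fun t : ℝ => n * t) ⁻¹' (Set.range ((↑) : ℤ → ℝ))ᶜ)

/-- The torsion function of `slitLine n`. -/
def slitTorsion (n : ℕ) (t : ℝ) : ℝ :=
  if 0 < t then t * (1 - t) / 2 else
    (t - (⌊n * t⌋ : ℝ) / n) * (((⌊n * t⌋ : ℝ) + 1) / n - t) / 2

lemma isOpen_slitLine (n : ℕ) : IsOpen (slitLine n) := by
  refine isOpen_Ioo.union (isOpen_Ioo.inter (IsOpen.preimage (by fun_prop) ?_))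
  exact Int.isClosedEmbedding_coe_real.isClosed_range.isOpen_compl

lemma slitTorsion_nonneg {n : ℕ} (hn : 0 < n) {t : ℝ} (ht : t < 1) : 0 ≤ slitTorsion n t := by
  have hn' : (0 : ℝ) < n := by exact_mod_cast hn
  rw [slitTorsion]
  split_ifs with h
  · have : 0 ≤ t * (1 - t) := mul_nonneg h.le (by linarith)
    linarith
  · have h1 : (⌊n * t⌋ : ℝ) / n ≤ t := by
      rw [div_le_iff₀ hn', mul_comm t]
      exact Int.floor_le _
    have h2 : t ≤ ((⌊n * t⌋ : ℝ) + 1) / n := by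
      rw [le_div_iff₀ hn', mul_comm t]
      exact (Int.lt_floor_add_one _).le
    have := mul_nonneg (sub_nonneg.2 h1) (sub_nonneg.2 h2)
    linarith

/-- On an interval of length `ℓ` the profile is at most `ℓ² / 8`. The cruder bounds `1` and `1 / n`
suffice. -/
lemma slitTorsion_le {n : ℕ} (hn : 0 < n) {t : ℝ} (ht : t < 1) :
    slitTorsion n t ≤ (Set.Ioo (0 : ℝ) 1).indicator 1 t + 1 / n := by
  have hn' : (0 : ℝ) < n := by exact_mod_cast hn
  rw [slitTorsion]
  split_ifs with h
  · rw [Set.indicator_of_mem (Set.mem_Ioo.2 ⟨h, ht⟩)]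
    have : 0 ≤ 1 / (n : ℝ) := by positivity
    simp only [Pi.one_apply]
    nlinarith
  · rw [Set.indicator_of_notMem (fun h' => h h'.1), zero_add]
    have h1 : (⌊n * t⌋ : ℝ) / n ≤ t := by
      rw [div_le_iff₀ hn', mul_comm t]
      exact Int.floor_le _
    have h2 : t ≤ ((⌊n * t⌋ : ℝ) + 1) / n := by
      rw [le_div_iff₀ hn', mul_comm t]
      exact (Int.lt_floor_add_one _).le
    have h3 : 1 / (n : ℝ) ≤ 1 := by
      rw [div_le_one hn']
      exact_mod_cast hn
    have h4 : ((⌊n * t⌋ : ℝ) + 1) / n = (⌊n * t⌋ : ℝ) / n + 1 / n := add_div _ _ _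
    rw [h4] at h2 ⊢
    nlinarith

/-- Away from the slits the floor is locally constant, so near each point the profile is a quadratic
with leading coefficient `-1/2`. Smoothness and second derivative `-1` are read off from this. -/
lemma slitTorsion_eventuallyEq {n : ℕ} {t : ℝ} (ht : t ∈ slitLine n) :
    ∃ a b : ℝ, slitTorsion n =ᶠ[𝓝 t] fun s => (s - a) * (b - s) / 2 := by
  rcases ht with ht | ⟨ht, hr⟩
  · refine ⟨0, 1, ?_⟩
    filter_upwards [lt_mem_nhds ht.1] with s hs
    rw [slitTorsion, if_pos hs, sub_zero]
  · have h1 : (⌊n * t⌋ : ℝ) < n * t :=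
      lt_of_le_of_ne (Int.floor_le _) fun h => hr ⟨_, h⟩
    have h2 : n * t < (⌊n * t⌋ : ℝ) + 1 := Int.lt_floor_add_one _
    have hc : Continuous fun s : ℝ => n * s := by fun_prop
    refine ⟨(⌊n * t⌋ : ℝ) / n, ((⌊n * t⌋ : ℝ) + 1) / n, ?_⟩
    filter_upwards [gt_mem_nhds ht.2, (hc.tendsto t).eventually (lt_mem_nhds h1),
      (hc.tendsto t).eventually (gt_mem_nhds h2)] with s hs hs1 hs2
    have : ⌊n * s⌋ = ⌊n * t⌋ := Int.floor_eq_iff.2 ⟨hs1.le, hs2⟩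
    rw [slitTorsion, if_neg hs.le.not_gt, this]

lemma contDiffAt_slitTorsion {n : ℕ} {t : ℝ} (ht : t ∈ slitLine n) :
    ContDiffAt ℝ ∞ (slitTorsion n) t := by
  obtain ⟨a, b, h⟩ := slitTorsion_eventuallyEq ht
  refine ContDiffAt.congr_of_eventuallyEq ?_ h
  fun_prop

lemma hasDerivAt_deriv_slitTorsion {n : ℕ} {t : ℝ} (ht : t ∈ slitLine n) :
    HasDerivAt (deriv (slitTorsion n)) (-1) t := by
  obtain ⟨a, b, h⟩ := slitTorsion_eventuallyEq ht
  have h1 : ∀ s : ℝ, HasDerivAt (fun s => (s - a) * (b - s) / 2) ((a + b) / 2 - s) s := by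
    intro s
    have := (((hasDerivAt_id s).sub_const a).mul ((hasDerivAt_id s).const_sub b)).div_const 2
    refine this.congr_deriv ?_
    simp
    ring
  have h2 : deriv (slitTorsion n) =ᶠ[𝓝 t] fun s => (a + b) / 2 - s := by
    refine h.deriv.trans (Eventually.of_forall fun s => ?_)
    exact (h1 s).deriv
  exact HasDerivAt.congr_of_eventuallyEq ((hasDerivAt_id t).const_sub _) h2

/-- The product of `U` in the `i₀`-th coordinate with the unit interval in the others. -/
def cylinder (i₀ : Fin m) (U : Set ℝ) : Set (EuclideanSpace ℝ (Fin m)) :=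
  {x | ∀ i, x i ∈ if i = i₀ then U else Set.Ioo 0 1}

lemma cylinder_mono (i₀ : Fin m) {U V : Set ℝ} (h : U ⊆ V) : cylinder i₀ U ⊆ cylinder i₀ V := by
  intro x hx i
  have := hx i
  split_ifs at this ⊢
  · exact h this
  · exact this

lemma mem_of_mem_cylinder {i₀ : Fin m} {U : Set ℝ} {x : EuclideanSpace ℝ (Fin m)}
    (hx : x ∈ cylinder i₀ U) : x i₀ ∈ U := by
  simpa using hx i₀

lemma isOpen_cylinder (i₀ : Fin m) {U : Set ℝ} (h : IsOpen U) : IsOpen (cylinder i₀ U) := by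
  rw [cylinder, Set.ofPred_forall]
  refine isOpen_iInter_of_finite fun i => IsOpen.preimage (by fun_prop) ?_
  split_ifs
  · exact h
  · exact isOpen_Ioo

lemma volume_cylinder (i₀ : Fin m) (U : Set ℝ) : volume (cylinder i₀ U) = volume U := by
  have h1 : cylinder i₀ U = (MeasurableEquiv.toLp 2 (Fin m → ℝ)).symm ⁻¹'
      (Set.univ.pi fun i => if i = i₀ then U else Set.Ioo 0 1) := by
    ext x
    simp [cylinder]
  rw [h1,
    (EuclideanSpace.volume_preserving_symm_measurableEquiv_toLp (Fin m)).measure_preimage_equiv,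
    volume_pi_pi, Finset.prod_eq_single i₀]
  · simp
  · intro i _ hi
    simp [hi]
  · simp

/-- The slits are countably many points, so they remove no measure. -/
lemma natCast_le_volume_slitLine {n : ℕ} (hn : 0 < n) : (n : ℝ≥0∞) ≤ volume (slitLine n) := by
  have hn' : (n : ℝ) ≠ 0 := by positivity
  have hc : ((fun t : ℝ => n * t) ⁻¹' (Set.range ((↑) : ℤ → ℝ))).Countable :=
    (Set.countable_range _).preimage (mul_right_injective₀ hn')
  have h1 : Set.Ioo (-n : ℝ) 0 ⊆
      slitLine n ∪ (fun t : ℝ => n * t) ⁻¹' (Set.range ((↑) : ℤ → ℝ)) := by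
    intro t ht
    by_cases h : t ∈ (fun t : ℝ => n * t) ⁻¹' (Set.range ((↑) : ℤ → ℝ))
    · exact Or.inr h
    · exact Or.inl (Or.inr ⟨ht, h⟩)
  calc (n : ℝ≥0∞) = volume (Set.Ioo (-n : ℝ) 0) := by simp
    _ ≤ _ := measure_mono h1
    _ ≤ volume (slitLine n) + 0 := by
      rw [← hc.measure_zero volume]
      exact measure_union_le _ _
    _ = _ := add_zero _

lemma slitLine_subset (n : ℕ) : slitLine n ⊆ Set.Ioo (-(n + 1) : ℝ) (n + 1) := by
  have hn : (0 : ℝ) ≤ n := by positivity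
  rintro t (⟨h1, h2⟩ | ⟨⟨h1, h2⟩, -⟩) <;> constructor <;> linarith

lemma lt_one_of_mem_slitLine {n : ℕ} {t : ℝ} (ht : t ∈ slitLine n) : t < 1 := by
  rcases ht with h | ⟨h, -⟩
  · exact h.2
  · linarith [h.2]

lemma volume_slitLine_lt_top (n : ℕ) : volume (slitLine n) < ⊤ :=
  (measure_mono (slitLine_subset n)).trans_lt (by simp)

lemma poincare_cylinder_slitLine (i₀ : Fin m) (n : ℕ) :
    Poincare (cylinder i₀ (slitLine n)) ((Real.pi / (2 * (n + 1))) ^ 2) := by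
  refine poincare_of_slab (v := EuclideanSpace.single i₀ (1 : ℝ)) (c := 0) (by simp)
    (by positivity) fun x hx => ?_
  have := slitLine_subset n (mem_of_mem_cylinder hx)
  rw [sub_zero, EuclideanSpace.inner_single_left, abs_lt]
  simpa using this

/-- Depending only on `x i₀`, the profile satisfies `-Δ f = 1`. Being nonnegative on `Ω` makes it a
supersolution, whatever its values on the lateral faces. -/
lemma torsion_le_slitTorsion (i₀ : Fin m) (n : ℕ) (hn : 0 < n) {v : EuclideanSpace ℝ (Fin m) → ℝ}
    (hv : IsTorsionFunction (cylinder i₀ (slitLine n)) v) :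
    ∀ᵐ x ∂volume.restrict (cylinder i₀ (slitLine n)), v x ≤ slitTorsion n (x i₀) := by
  set Ω := cylinder i₀ (slitLine n) with hΩdef
  have hΩ : IsOpen Ω := isOpen_cylinder i₀ (isOpen_slitLine n)
  set e : EuclideanSpace ℝ (Fin m) := EuclideanSpace.single i₀ 1 with he
  have hmem : ∀ x ∈ Ω, x i₀ ∈ slitLine n := fun x hx => mem_of_mem_cylinder hx
  have := comparison (σ := -1) (f := fun x => slitTorsion n (x i₀))
    (Gf := fun x => deriv (slitTorsion n) (x i₀) • e) hΩ (by positivity)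
    (poincare_cylinder_slitLine i₀ n) hv (by norm_num) ?_ ?_ ?_ ?_
  · filter_upwards [this] with x hx
    linarith
  · intro x hx
    refine ContDiffAt.contDiffWithinAt ?_
    exact (contDiffAt_slitTorsion (hmem x hx)).comp (f := fun x : EuclideanSpace ℝ (Fin m) => x i₀)
      x (by fun_prop)
  · intro x hx
    rw [hasGradientAt_iff_hasFDerivAt]
    have h1 := ((contDiffAt_slitTorsion (hmem x hx)).differentiableAt (by simp)).hasDerivAt
    have h2 := h1.comp_hasFDerivAt x (EuclideanSpace.proj (𝕜 := ℝ) i₀).hasFDerivAt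
    refine h2.congr_fderiv ?_
    ext y
    simp [he, EuclideanSpace.inner_single_left]
  -- Here `σ = -1` and `f ≥ 0`, so `ε ≤ σ f` never occurs and the empty set serves.
  · intro ε hε
    refine ⟨∅, isCompact_empty, Set.empty_subset _, fun x hx h => ?_⟩
    have := slitTorsion_nonneg hn (lt_one_of_mem_slitLine (hmem x hx))
    linarith
  · intro ψ hψ _
    have hd : ∀ x ∈ tsupport ψ, HasLineDerivAt ℝ
        (fun x : EuclideanSpace ℝ (Fin m) => deriv (slitTorsion n) (x i₀)) (-1) x e := by
      intro x hx
      have h2 := (hasDerivAt_deriv_slitTorsion (hmem x (hψ.2.2 hx))).comp_hasFDerivAt x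
        (EuclideanSpace.proj (𝕜 := ℝ) i₀).hasFDerivAt
      have h3 := h2.hasLineDerivAt e
      simpa [he] using! h3
    have hc : ContinuousOn (fun x : EuclideanSpace ℝ (Fin m) => deriv (slitTorsion n) (x i₀))
        (tsupport ψ) := by
      intro x hx
      exact ((hasDerivAt_deriv_slitTorsion (hmem x (hψ.2.2 hx))).continuousAt.comp
        (f := fun x : EuclideanSpace ℝ (Fin m) => x i₀) (by fun_prop)).continuousWithinAt
    have h1 := integral_mul_lineDeriv (f' := fun _ => -1) hψ.1 hψ.2.1 hc continuousOn_const hd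
    rw [IsTestFunction.setIntegral_eq (fun x hx => by simp [hψ.gradient_eq_zero hx]),
      IsTestFunction.setIntegral_eq (fun x hx => hψ.eq_zero hx)]
    simp only [inner_gradient_right, map_smul, smul_eq_mul, conj_trivial]
    have h2 : ∫ x, deriv (slitTorsion n) (x i₀) * fderiv ℝ ψ x e = ∫ x, ψ x := by
      rw [integral_mul_const] at h1
      simp only [mul_comm (deriv _ _)]
      linarith
    rw [h2]

lemma torsion_nonneg {Ω : Set (EuclideanSpace ℝ (Fin m))} (hΩ : IsOpen Ω) {κ : ℝ} (hκ : 0 < κ)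
    (hP : Poincare Ω κ) {v : EuclideanSpace ℝ (Fin m) → ℝ} (hv : IsTorsionFunction Ω v) :
    ∀ᵐ x ∂volume.restrict Ω, 0 ≤ v x := by
  have := comparison (σ := 1) (f := fun _ => (0 : ℝ)) (Gf := fun _ => 0) hΩ hκ hP hv (by norm_num)
    contDiffOn_const (fun x _ => hasGradientAt_const x 0)
    (fun ε hε => ⟨∅, isCompact_empty, Set.empty_subset _, fun x _ h => by simp at h; linarith⟩)
    (fun ψ _ h0 => by simpa using integral_nonneg h0)
  simpa using this

/-- Minkowski's inequality separates the unit cube, of volume at most `1`, from the uniform error `1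
/ n`. -/
lemma T_cylinder_slitLine_le (i₀ : Fin m) {n : ℕ} (hn : 0 < n) {p : ℝ} (hp : 1 ≤ p) :
    T p (cylinder i₀ (slitLine n)) ≤
      1 + (n : ℝ≥0∞)⁻¹ * volume (cylinder i₀ (slitLine n)) ^ (1 / p) := by
  set Ω := cylinder i₀ (slitLine n) with hΩdef
  have hΩ : IsOpen Ω := isOpen_cylinder i₀ (isOpen_slitLine n)
  -- In the absence of a solution the default value `0` makes the bound trivial.
  by_cases h : ∃ v, IsTorsionFunction Ω v
  swap
  · simp [T, torsionFunction, dif_neg h]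
  have hv := torsionFunction_spec h
  have hmem : ∀ x ∈ Ω, x i₀ ∈ slitLine n := fun x hx => mem_of_mem_cylinder hx
  set A : Set (EuclideanSpace ℝ (Fin m)) := {x | x i₀ ∈ Set.Ioo (0 : ℝ) 1} with hA
  have hAm : MeasurableSet A :=
    (isOpen_Ioo.preimage (by fun_prop : Continuous fun x : EuclideanSpace ℝ (Fin m) =>
      x i₀)).measurableSet
  have hp0 : ENNReal.ofReal p ≠ 0 := by simpa using by linarith
  have hp1 : (1 : ℝ≥0∞) ≤ ENNReal.ofReal p := by simpa using ENNReal.ofReal_le_ofReal hp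
  have hpr : (ENNReal.ofReal p).toReal = p := ENNReal.toReal_ofReal (by linarith)
  have hbound : ∀ᵐ x ∂volume.restrict Ω,
      ‖torsionFunction Ω x‖ ≤ A.indicator (fun _ => (1 : ℝ)) x + 1 / n := by
    filter_upwards [torsion_le_slitTorsion i₀ n hn hv,
      torsion_nonneg hΩ (by positivity) (poincare_cylinder_slitLine i₀ n) hv,
      ae_restrict_mem hΩ.measurableSet] with x h1 h2 hx
    rw [Real.norm_of_nonneg h2]
    exact h1.trans (slitTorsion_le hn (lt_one_of_mem_slitLine (hmem x hx)))
  calc T p Ω ≤ eLpNorm (fun x => A.indicator (fun _ => (1 : ℝ)) x + 1 / n) (ENNReal.ofReal p)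
        (volume.restrict Ω) := eLpNorm_mono_ae_real hbound
    _ ≤ eLpNorm (A.indicator fun _ => (1 : ℝ)) (ENNReal.ofReal p) (volume.restrict Ω) +
        eLpNorm (fun _ => (1 / n : ℝ)) (ENNReal.ofReal p) (volume.restrict Ω) :=
      eLpNorm_add_le (aestronglyMeasurable_const.indicator hAm) aestronglyMeasurable_const hp1
    _ ≤ _ := by
      gcongr
      · refine (eLpNorm_indicator_const_le _ _).trans ?_
        rw [Measure.restrict_apply hAm, hpr]
        have h1 : A ∩ Ω ⊆ cylinder i₀ (Set.Ioo 0 1) := by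
          rintro x ⟨h1, h2⟩ i
          have := h2 i
          split_ifs at this ⊢ with hi
          · rw [hi]
            exact h1
          · exact this
        have h2 : volume (A ∩ Ω) ≤ 1 := by
          refine (measure_mono h1).trans ?_
          rw [volume_cylinder]
          simp
        simpa using ENNReal.rpow_le_one h2 (by positivity)
      · rw [eLpNorm_const' _ hp0 ENNReal.ofReal_ne_top, hpr, Measure.restrict_apply_univ,
          Real.enorm_of_nonneg (by positivity), one_div, ENNReal.ofReal_inv_of_pos (by positivity),
          ENNReal.ofReal_natCast]

/-- A bound on `λ₁` for all open sets containing a fixed one. -/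
lemma exists_lambda1_le {Q : Set (EuclideanSpace ℝ (Fin m))} (hQ : IsOpen Q) (hne : Q.Nonempty) :
    ∃ C : ℝ≥0∞, C ≠ ⊤ ∧ ∀ Ω, Q ⊆ Ω → lambda1 Ω ≤ C := by
  obtain ⟨x₀, hx₀⟩ := hne
  obtain ⟨φ, hφs, hφc, hφd, -, hφ1⟩ :=
    exists_contDiff_tsupport_subset (n := ⊤) (hQ.mem_nhds hx₀)
  have hφ : IsTestFunction Q φ := ⟨hφd, hφc, hφs⟩
  have hne0 : ¬ φ =ᵐ[volume.restrict Q] 0 := by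
    intro h0
    have h1 : φ =ᵐ[volume] 0 := by
      rw [Filter.EventuallyEq, ae_restrict_iff' hQ.measurableSet] at h0
      filter_upwards [h0] with x hx
      by_cases hxQ : x ∈ Q
      · exact hx hxQ
      · exact hφ.eq_zero hxQ
    have h2 := (Continuous.ae_eq_iff_eq volume hφd.continuous continuous_zero).1 h1
    rw [h2] at hφ1
    simp at hφ1
  refine ⟨(∫⁻ x, ‖gradient φ x‖ₑ ^ 2) / (∫⁻ x in Q, ‖φ x‖ₑ ^ 2), ?_, fun Ω hΩ => ?_⟩
  · rw [← eLpNorm_two_sq, ← eLpNorm_two_sq]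
    refine ENNReal.div_ne_top (ENNReal.pow_ne_top hφ.memLp_gradient.2.ne) (pow_ne_zero _ ?_)
    exact fun h' => hne0 ((eLpNorm_eq_zero_iff (hφ.memLp.restrict Q).1 (by norm_num)).1 h')
  · have hφΩ : IsTestFunction Ω φ := ⟨hφd, hφc, hφs.trans hΩ⟩
    refine (iInf₂_le φ (gradient φ)).trans ((iInf₂_le hφΩ.memH01 ?_).trans ?_)
    · exact fun h => hne0 (ae_restrict_of_ae_restrict_of_subset hΩ h)
    · gcongr
      exact Measure.restrict_le_self

theorem G_eq_zero (hm : 1 ≤ m) {p : ℝ} (hp : 1 ≤ p) : G m p = 0 := by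
  set i₀ : Fin m := ⟨0, hm⟩
  have hp0 : 0 < 1 / p := by positivity
  obtain ⟨C, hC, hlam⟩ :=
    exists_lambda1_le (isOpen_cylinder i₀ (isOpen_Ioo (a := (0 : ℝ)) (b := 1)))
    (by
      refine ⟨WithLp.toLp 2 fun _ => 1 / 2, fun i => ?_⟩
      split_ifs <;> norm_num)
  have key : ∀ n : ℕ,
      G m p ≤ (((n + 1 : ℕ) : ℝ≥0∞) ^ (1 / p))⁻¹ * C + ((n + 1 : ℕ) : ℝ≥0∞)⁻¹ * C := by
    intro n
    have hn : 0 < n + 1 := n.succ_pos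
    set Ω := cylinder i₀ (slitLine (n + 1)) with hΩdef
    have hvol : ((n + 1 : ℕ) : ℝ≥0∞) ≤ volume Ω := by
      rw [hΩdef, volume_cylinder]
      exact natCast_le_volume_slitLine hn
    have hpos : 0 < volume Ω := lt_of_lt_of_le (by simp) hvol
    have hfin : volume Ω < ⊤ := by
      rw [hΩdef, volume_cylinder]
      exact volume_slitLine_lt_top _
    have hV0 : volume Ω ^ (1 / p) ≠ 0 := by
      simpa using ⟨fun h => absurd h hpos.ne', fun h => absurd h hfin.ne⟩
    have hVt : volume Ω ^ (1 / p) ≠ ⊤ := ENNReal.rpow_ne_top_of_nonneg hp0.le hfin.ne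
    calc G m p ≤ F p Ω :=
          iInf_le_of_le Ω (iInf_le_of_le (isOpen_cylinder i₀ (isOpen_slitLine _))
            (iInf_le_of_le hpos (iInf_le _ hfin)))
      _ ≤ (1 + ((n + 1 : ℕ) : ℝ≥0∞)⁻¹ * volume Ω ^ (1 / p)) * C / volume Ω ^ (1 / p) := by
        rw [F]
        gcongr
        · exact T_cylinder_slitLine_le i₀ hn hp
        · exact hlam Ω (cylinder_mono i₀ Set.subset_union_left)
      _ = (volume Ω ^ (1 / p))⁻¹ * C + ((n + 1 : ℕ) : ℝ≥0∞)⁻¹ * C := by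
        rw [add_mul, one_mul, ENNReal.add_div, ENNReal.div_eq_inv_mul (a := C)]
        congr 1
        rw [mul_right_comm, ENNReal.mul_div_cancel_right hV0 hVt]
      _ ≤ _ := by gcongr
  have hnat : Tendsto (fun n : ℕ => ((n + 1 : ℕ) : ℝ≥0∞)) atTop (𝓝 ⊤) :=
    ENNReal.tendsto_nat_nhds_top.comp (tendsto_add_atTop_nat 1)
  have h1 : Tendsto (fun n : ℕ => (((n + 1 : ℕ) : ℝ≥0∞) ^ (1 / p))⁻¹ * C) atTop (𝓝 0) := by
    have := ((ENNReal.continuous_rpow_const (y := 1 / p)).tendsto ⊤).comp hnat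
    rw [ENNReal.top_rpow_of_pos hp0] at this
    have := ENNReal.Tendsto.mul_const (b := C) (tendsto_inv_iff.2 this) (Or.inr hC)
    simpa using this
  have h2 : Tendsto (fun n : ℕ => ((n + 1 : ℕ) : ℝ≥0∞)⁻¹ * C) atTop (𝓝 0) := by
    have := ENNReal.Tendsto.mul_const (b := C) (tendsto_inv_iff.2 hnat) (Or.inr hC)
    simpa using this
  have h3 := ge_of_tendsto' (h1.add h2) key
  simpa using h3

end UnboundedFamily

/-! ### John ellipsoids of convex sets -/

section John

variable {E : Type*} [NormedAddCommGroup E] [InnerProductSpace ℝ E]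

/-- A convex open set of finite measure is bounded. -/
lemma isBounded_of_convex_of_volume_lt_top [MeasurableSpace E] [BorelSpace E]
    [FiniteDimensional ℝ E] {Ω : Set E} (hΩ : IsOpen Ω)
    (hc : Convex ℝ Ω) (hne : Ω.Nonempty) (hfin : volume Ω < ⊤) : Bornology.IsBounded Ω := by
  obtain ⟨x₀, hx₀⟩ := hne
  obtain ⟨r, hr, hball⟩ := Metric.isOpen_iff.1 hΩ x₀ hx₀
  have hpos : 0 < volume (Metric.ball (0 : E) (r / 2)) :=
    Metric.measure_ball_pos _ _ (by positivity)
  have hne : volume (Metric.ball (0 : E) (r / 2)) ≠ ⊤ := measure_ball_lt_top.ne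
  obtain ⟨N, hN⟩ := ENNReal.exists_nat_mul_gt hpos.ne' hfin.ne
  by_contra hb
  obtain ⟨p, hp, hpd⟩ : ∃ p ∈ Ω, r * (2 * N) < ‖p - x₀‖ := by
    by_contra! h
    refine hb ((Metric.isBounded_closedBall (x := x₀) (r := r * (2 * N))).subset fun y hy => ?_)
    rw [mem_closedBall_iff_norm]
    exact h y hy
  have hN0 : 0 < (N : ℝ) := by
    rcases Nat.eq_zero_or_pos N with h | h
    · simp [h] at hN
    · exact_mod_cast h
  -- These centres lie in the first half of the segment from `x₀` to the far point `p`. Convexity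
  -- shrinks the ball of radius `r` at `x₀` towards `p` by a factor at least `1/2`, so radius `r /
  -- 2` fits. The spacing `‖p - x₀‖ / (2N)` exceeds `r`, so the `N` balls are disjoint and their
  -- total volume is too large.
  set c : ℕ → E := fun i => x₀ + ((i : ℝ) / (2 * N)) • (p - x₀) with hcdef
  have hsub : ∀ i ∈ Finset.range N, Metric.ball (c i) (r / 2) ⊆ Ω := by
    intro i hi y hy
    have hiN : (i : ℝ) < N := by exact_mod_cast Finset.mem_range.1 hi
    set t : ℝ := (i : ℝ) / (2 * N) with ht
    have ht0 : 0 ≤ t := by positivity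
    have ht1 : t ≤ 1 / 2 := by
      rw [ht, div_le_div_iff₀ (by positivity) (by norm_num)]
      linarith
    have h1t : 0 < 1 - t := by linarith
    have hz : x₀ + (1 - t)⁻¹ • (y - c i) ∈ Ω := by
      apply hball
      rw [mem_ball_iff_norm] at hy ⊢
      rw [add_sub_cancel_left, norm_smul, Real.norm_of_nonneg (by positivity),
        inv_mul_lt_iff₀ h1t]
      nlinarith
    have := hc hz hp h1t.le ht0 (by ring)
    convert this using 1
    rw [smul_add, smul_smul, mul_inv_cancel₀ h1t.ne', one_smul, hcdef]
    module
  have hdisj : Set.PairwiseDisjoint (↑(Finset.range N)) fun i => Metric.ball (c i) (r / 2) := by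
    intro i _ j _ hij
    refine Metric.ball_disjoint_ball ?_
    rw [dist_eq_norm]
    have : c i - c j = (((i : ℝ) - j) / (2 * N)) • (p - x₀) := by
      simp only [hcdef]
      module
    rw [this, norm_smul, norm_div, Real.norm_of_nonneg (by positivity : (0 : ℝ) ≤ 2 * N),
      div_mul_eq_mul_div, le_div_iff₀ (by positivity)]
    have h1 : (1 : ℝ) ≤ ‖(i : ℝ) - j‖ := by
      have : (1 : ℤ) ≤ |(i : ℤ) - j| := Int.one_le_abs (sub_ne_zero.2 (by exact_mod_cast hij))
      rw [Real.norm_eq_abs]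
      exact_mod_cast this
    nlinarith [norm_nonneg (p - x₀)]
  have hm : volume (⋃ i ∈ Finset.range N, Metric.ball (c i) (r / 2)) =
      N * volume (Metric.ball (0 : E) (r / 2)) := by
    rw [measure_biUnion_finset hdisj fun i _ => measurableSet_ball]
    simp [Measure.addHaar_ball_center]
  have := measure_mono (μ := volume) (Set.iUnion₂_subset hsub)
  rw [hm] at this
  exact absurd hN this.not_gt

/-- The linear map with eigenvalue `a` on the line spanned by the unit vector `e` and eigenvalue `b`
on its orthogonal complement. -/
def axisScaling (e : E) (a b : ℝ) : E →L[ℝ] E :=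
  b • ContinuousLinearMap.id ℝ E + (a - b) • (innerSL ℝ e).smulRight e

lemma axisScaling_apply (e : E) (a b : ℝ) (x : E) :
    axisScaling e a b x = b • x + ((a - b) * inner ℝ e x) • e := by
  simp [axisScaling, smul_smul]

lemma inner_axisScaling (e : E) (a b : ℝ) (x y : E) :
    inner ℝ (axisScaling e a b x) y = inner ℝ x (axisScaling e a b y) := by
  simp only [axisScaling_apply, inner_add_left, inner_add_right, inner_smul_left, inner_smul_right,
    conj_trivial]
  rw [real_inner_comm x e]
  ring

lemma norm_axisScaling_sq {e : E} (he : ‖e‖ = 1) (a b : ℝ) (x : E) :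
    ‖axisScaling e a b x‖ ^ 2 = b ^ 2 * ‖x‖ ^ 2 + (a ^ 2 - b ^ 2) * inner ℝ e x ^ 2 := by
  rw [axisScaling_apply, norm_add_sq_real, norm_smul, norm_smul, inner_smul_left, inner_smul_right,
    he, real_inner_comm, mul_pow, mul_pow, Real.norm_eq_abs, Real.norm_eq_abs, sq_abs, sq_abs]
  simp only [conj_trivial]
  ring

/-- Up to the factor `b` this is a rank-one perturbation of the identity, whose determinant is `1`
plus the trace of the perturbation. -/
lemma det_axisScaling [FiniteDimensional ℝ E] {e : E} (he : ‖e‖ = 1) (a : ℝ) {b : ℝ} (hb : b ≠ 0) :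
    (axisScaling e a b).det = b ^ Module.finrank ℝ E * (a / b) := by
  have h : ((axisScaling e a b : E →L[ℝ] E) : E →ₗ[ℝ] E) =
      b • LinearMap.transvection (innerₛₗ ℝ e) (((a - b) / b) • e) := by
    ext x
    simp only [ContinuousLinearMap.coe_coe, axisScaling_apply, LinearMap.smul_apply,
      LinearMap.transvection.apply, innerₛₗ_apply_apply, smul_add, smul_smul]
    congr 2
    field_simp
  rw [ContinuousLinearMap.det, h, LinearMap.det_smul, LinearMap.transvection.det]
  congr 1
  rw [map_smul, innerₛₗ_apply_apply, real_inner_self_eq_norm_sq, he]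
  have h1 : b * ((a - b) / b) = a - b := by field_simp
  have h2 : a / b = 1 + (a - b) / b := by field_simp; ring
  simp [h2]

/-- Comparison of support functions in a direction of norm `N` and component `τ` along `e`. On the
left is the ellipsoid with centre `s e` and semi-axes `1 + s` along `e`, `√(1 - β)` across; on the
right, the convex hull of the unit ball and `d e`. The relation between `β` and `s` makes the
differences of squares factor, with signs given by which term attains the maximum. -/
lemma ellipsoid_support_le {d s β N τ W : ℝ} (hs : 0 < s) (hs1 : s ≤ 1)
    (hsd : s ≤ (d - 1) / 4) (hβ1 : β ≤ 1) (hβ0 : 0 ≤ β) (hβ : β * (d - 1) = 2 * s) (hτ : |τ| ≤ N)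
    (hW : W ^ 2 = (1 - β) * N ^ 2 + ((1 + s) ^ 2 - (1 - β)) * τ ^ 2) :
    s * τ + W ≤ max N (d * τ) := by
  have hN : 0 ≤ N := (abs_nonneg τ).trans hτ
  rw [abs_le] at hτ
  rcases le_total (d * τ) N with h | h
  · refine le_max_of_le_left ?_
    have h0 : s * τ ≤ N := (mul_le_mul_of_nonneg_left hτ.2 hs.le).trans
      (mul_le_of_le_one_left hN hs1)
    have h1 : W ≤ N - s * τ := by
      refine (abs_le_of_sq_le_sq' ?_ (by linarith)).2
      rw [hW]
      have h2 : 0 ≤ (N + τ) * β * (N - d * τ) :=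
        mul_nonneg (mul_nonneg (by linarith) hβ0) (by linarith)
      have h3 : (N - s * τ) ^ 2 - ((1 - β) * N ^ 2 + ((1 + s) ^ 2 - (1 - β)) * τ ^ 2) =
          (N + τ) * β * (N - d * τ) := by
        linear_combination (N * τ + τ ^ 2) * hβ
      linarith
    linarith
  · refine le_max_of_le_right ?_
    have hτ0 : 0 ≤ τ := nonneg_of_mul_nonneg_right (hN.trans h) (by linarith)
    have h1 : W ≤ (d - s) * τ := by
      refine (abs_le_of_sq_le_sq' ?_ (mul_nonneg (by linarith) hτ0)).2
      rw [hW]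
      have h2 : 0 ≤ (1 - β) * ((d * τ) ^ 2 - N ^ 2) :=
        mul_nonneg (by linarith) (sub_nonneg.2 (pow_le_pow_left₀ hN h 2))
      have h3 : ((d - s) * τ) ^ 2 - ((1 - β) * N ^ 2 + ((1 + s) ^ 2 - (1 - β)) * τ ^ 2) =
          (1 - β) * ((d * τ) ^ 2 - N ^ 2) := by
        linear_combination (τ ^ 2 * (d + 1)) * hβ
      linarith
    linarith

/-- The right side is the squared volume ratio of the stretched ellipsoid to the ball. Bernoulli
bounds it below by `(1 - 2sq)(1 + s)² = 1 + 2s(1 - q) + O(s²)`, which exceeds `1` for small `s` as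
`q < 1`. -/
lemma ellipsoid_volume_gt (k : ℕ) {s q β : ℝ} (hs : 0 < s) (hs1 : s ≤ 1) (hsq : s ≤ (1 - q) / 4)
    (hβ : β ≤ 1) (hk : (k : ℝ) * β = 2 * s * q) : 1 < (1 - β) ^ k * (1 + s) ^ 2 := by
  have h1 : 1 + (k : ℝ) * -β ≤ (1 + -β) ^ k := one_add_mul_le_pow (by linarith) k
  have h3 : 1 - 2 * s * q ≤ (1 - β) ^ k := by
    rw [← sub_eq_add_neg] at h1
    linarith
  have h4 : (1 - 2 * s * q) * (1 + s) ^ 2 ≤ (1 - β) ^ k * (1 + s) ^ 2 := by gcongr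
  refine lt_of_lt_of_le ?_ h4
  have h5 : 0 ≤ s * (1 - q - 4 * s) := mul_nonneg hs.le (by linarith)
  have h6 : 0 ≤ s ^ 2 * (1 - q) := mul_nonneg (sq_nonneg _) (by linarith)
  have h7 : 0 ≤ s ^ 3 * (1 - q) := mul_nonneg (by positivity) (by linarith)
  have h9 : 0 < s ^ 2 := by positivity
  have h10 : (1 - 2 * s * q) * (1 + s) ^ 2 =
      1 + 2 * s * (1 - q) + s ^ 2 - 4 * s ^ 2 * q - 2 * s ^ 3 * q := by ring
  have h8 : 0 ≤ s ^ 2 * (1 - s) := mul_nonneg (sq_nonneg _) (by linarith)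
  linarith

/-- If a convex open set contains the unit ball and a point at distance larger than the dimension,
then it contains an ellipsoid of larger volume than the ball. -/
lemma exists_larger_ellipsoid [FiniteDimensional ℝ E] {Ω : Set E} (hΩ : IsOpen Ω)
    (hc : Convex ℝ Ω) (hball : Metric.ball 0 1 ⊆ Ω) {p : E} (hp : p ∈ Ω)
    (hm : 1 ≤ Module.finrank ℝ E) (hpm : (Module.finrank ℝ E : ℝ) < ‖p‖) :
    ∃ (c : E) (D : E →L[ℝ] E), (∀ x, ‖x‖ < 1 → c + D x ∈ Ω) ∧ 1 < |D.det| := by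
  obtain ⟨k, hk⟩ : ∃ k, Module.finrank ℝ E = k + 1 := ⟨_, (Nat.sub_add_cancel hm).symm⟩
  rw [hk] at hpm
  push_cast at hpm
  set d := ‖p‖ with hd
  have hk0 : (0 : ℝ) ≤ k := by positivity
  have hd1 : 0 < d - 1 := by linarith
  set q := (k : ℝ) / (d - 1) with hq
  have hq0 : 0 ≤ q := by positivity
  have hq1 : q < 1 := by rw [hq, div_lt_one hd1]; linarith
  -- The first bound makes the volume grow and the second keeps the ellipsoid in the hull. The
  -- assumption that `p` is farther than the dimension is exactly `q < 1`.
  obtain ⟨s, hs0, hs1, hs2⟩ : ∃ s : ℝ, 0 < s ∧ s ≤ (1 - q) / 4 ∧ s ≤ (d - 1) / 4 :=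
    ⟨min ((1 - q) / 4) ((d - 1) / 4), lt_min (by linarith) (by linarith), min_le_left _ _,
      min_le_right _ _⟩
  set β := 2 * s / (d - 1) with hβ
  have hβ0 : 0 < β := by positivity
  have hβ1 : β < 1 := by rw [hβ, div_lt_one hd1]; linarith
  have hβd : β * (d - 1) = 2 * s := by rw [hβ]; field_simp
  have hb0 : 0 < Real.sqrt (1 - β) := Real.sqrt_pos.2 (by linarith)
  have hb2 : Real.sqrt (1 - β) ^ 2 = 1 - β := Real.sq_sqrt (by linarith)
  set b := Real.sqrt (1 - β) with hb
  set e : E := d⁻¹ • p with he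
  have hd0 : 0 < d := by linarith
  have he1 : ‖e‖ = 1 := by
    rw [he, norm_smul, Real.norm_of_nonneg (by positivity), ← hd]
    field_simp
  have hpe : p = d • e := by rw [he, smul_smul, mul_inv_cancel₀ hd0.ne', one_smul]
  refine ⟨s • e, axisScaling e (1 + s) b, fun x hx => ?_, ?_⟩
  -- Separate the missing point from `Ω` by a functional `⟪n, ·⟫`. Its value `M` there dominates the
  -- support function of the hull of the ball and `p`, contradicting `ellipsoid_support_le`.
  · by_contra hy
    obtain ⟨f, hf⟩ := geometric_hahn_banach_open_point hc hΩ hy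
    set n : E := (InnerProductSpace.toDual ℝ E).symm f with hn
    have hfn : ∀ y, f y = inner ℝ n y := fun y => by
      rw [hn, InnerProductSpace.toDual_symm_apply]
    simp only [hfn] at hf
    set τ : ℝ := inner ℝ e n with hτ
    set M := inner ℝ n (s • e + axisScaling e (1 + s) b x) with hM
    have hM1 : M ≤ s * τ + ‖axisScaling e (1 + s) b n‖ := by
      rw [hM, inner_add_right, inner_smul_right, ← inner_axisScaling, real_inner_comm]
      refine add_le_add le_rfl ((real_inner_le_norm _ _).trans ?_)
      exact mul_le_of_le_one_right (norm_nonneg _) hx.le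
    have hp' : d * τ < M := by
      have := hf p hp
      rwa [hpe, inner_smul_right, real_inner_comm] at this
    have hN : ‖n‖ ≤ M := by
      refine le_of_forall_lt fun t ht => ?_
      rcases eq_or_ne n 0 with h0 | h0
      · have := hf 0 (hball (by simp))
        simp only [h0, norm_zero] at ht
        rw [inner_zero_right] at this
        linarith
      · have hnpos : 0 < ‖n‖ := norm_pos_iff.2 h0
        set t' := max t 0 with ht'
        have ht'1 : t' < ‖n‖ := max_lt ht hnpos
        have := hf ((t' / ‖n‖ ^ 2) • n) (hball (by
          rw [mem_ball_zero_iff, norm_smul, Real.norm_of_nonneg (by positivity), sq,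
            div_mul_eq_mul_div, div_lt_one (by positivity)]
          nlinarith))
        rw [inner_smul_right, real_inner_self_eq_norm_sq, div_mul_cancel₀ _ (by positivity)] at this
        exact (le_max_left _ _).trans_lt this
    have hτN : |τ| ≤ ‖n‖ := by
      simpa [he1] using abs_real_inner_le_norm e n
    have hnorm := norm_axisScaling_sq he1 (1 + s) b n
    rw [← hτ, hb2] at hnorm
    have hs3 : s ≤ 1 / 4 := by linarith
    rw [abs_le] at hτN
    have hM0 : 0 < M := by simpa using hf 0 (hball (by simp))
    have hn0 : 0 < ‖n‖ := norm_pos_iff.2 fun h0 => by simp [hM, h0] at hM0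
    -- As `hN` is not strict, strictness is drawn from `‖x‖ < 1`.
    have hM2 : M < s * τ + ‖axisScaling e (1 + s) b n‖ := by
      rcases (norm_nonneg (axisScaling e (1 + s) b n)).eq_or_lt with h0 | h0
      · rw [← h0] at hM1
        nlinarith
      · rw [hM, inner_add_right, inner_smul_right, ← inner_axisScaling, real_inner_comm]
        refine add_lt_add_of_le_of_lt le_rfl ((real_inner_le_norm _ _).trans_lt ?_)
        exact mul_lt_of_lt_one_right h0 hx
    have := ellipsoid_support_le hs0 (by linarith) hs2 hβ1.le hβ0.le hβd (abs_le.2 hτN) hnorm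
    rcases le_max_iff.1 this with h | h <;> linarith
  · rw [det_axisScaling he1 _ hb0.ne', hk, pow_succ, mul_assoc, mul_div_cancel₀ _ hb0.ne',
      abs_of_nonneg (by positivity)]
    refine lt_of_pow_lt_pow_left₀ 2 (by positivity) ?_
    rw [one_pow, mul_pow, ← pow_mul, mul_comm k 2, pow_mul, hb2]
    have h2 : (k : ℝ) * β = 2 * s * q := by rw [hβ, hq]; ring
    exact ellipsoid_volume_gt k hs0 (by linarith) (by linarith) hβ1.le h2

/-- The John position of a bounded convex open set: it contains an ellipsoid and is contained in the
concentric ellipsoid dilated by the dimension. -/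
theorem exists_john_ellipsoid [FiniteDimensional ℝ E] {Ω : Set E} (hΩ : IsOpen Ω)
    (hc : Convex ℝ Ω) (hne : Ω.Nonempty) (hb : Bornology.IsBounded Ω)
    (hm : 1 ≤ Module.finrank ℝ E) :
    ∃ (c : E) (A : E ≃L[ℝ] E), (∀ x, ‖x‖ < 1 → c + A x ∈ Ω) ∧
      ∀ x, c + A x ∈ Ω → ‖x‖ < Module.finrank ℝ E := by
  have hK : IsCompact (closure Ω) := hb.isCompact_closure
  have : ProperSpace (E →L[ℝ] E) := FiniteDimensional.proper ℝ _
  obtain ⟨R, hR⟩ := hK.isBounded.exists_norm_le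
  set S : Set (E × (E →L[ℝ] E)) := {z | ∀ x, ‖x‖ ≤ 1 → z.1 + z.2 x ∈ closure Ω} with hS
  have hSc : IsCompact S := by
    refine Metric.isCompact_of_isClosed_isBounded ?_ ?_
    · have : S = ⋂ (x : E) (_ : ‖x‖ ≤ 1), {z | z.1 + z.2 x ∈ closure Ω} := by
        ext z
        simp [hS]
      rw [this]
      refine isClosed_iInter fun x => isClosed_iInter fun _ => ?_
      exact isClosed_closure.preimage (by fun_prop : Continuous fun z : E × (E →L[ℝ] E) =>
        z.1 + z.2 x)
    · refine (isBounded_iff_forall_norm_le).2 ⟨max R (2 * R), fun z hz => ?_⟩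
      have h1 : ‖z.1‖ ≤ R := hR _ (by simpa using hz 0 (by simp))
      have hR0 : 0 ≤ R := (norm_nonneg _).trans h1
      refine max_le_max h1 (ContinuousLinearMap.opNorm_le_of_unit_norm (by positivity)
        fun x hx => ?_)
      have h2 := hR _ (hz x hx.le)
      have h3 : z.2 x = (z.1 + z.2 x) - z.1 := by abel
      rw [h3]
      exact (norm_sub_le _ _).trans (by linarith)
  obtain ⟨x₀, hx₀⟩ := hne
  obtain ⟨r, hr, hball⟩ := Metric.nhds_basis_closedBall.mem_iff.1 (hΩ.mem_nhds hx₀)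
  have h0S : (x₀, r • ContinuousLinearMap.id ℝ E) ∈ S := by
    intro x hx
    refine subset_closure (hball ?_)
    rw [mem_closedBall_iff_norm]
    simp only [smul_apply, ContinuousLinearMap.id_apply, add_sub_cancel_left,
      norm_smul, Real.norm_of_nonneg hr.le]
    exact mul_le_of_le_one_right hr.le hx
  obtain ⟨⟨c, A⟩, hcA, hmax⟩ := hSc.exists_isMaxOn ⟨_, h0S⟩
    (f := fun z : E × (E →L[ℝ] E) => |z.2.det|)
    (ContinuousLinearMap.continuous_det.comp continuous_snd).abs.continuousOn
  have hdet0 : 0 < |A.det| := by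
    refine lt_of_lt_of_le ?_ (hmax h0S)
    have : (r • ContinuousLinearMap.id ℝ E : E →L[ℝ] E).det = r ^ Module.finrank ℝ E := by
      rw [ContinuousLinearMap.det]
      simp
    simp only [this]
    positivity
  have hdet : A.det ≠ 0 := abs_pos.1 hdet0
  set A' : E ≃L[ℝ] E := A.toContinuousLinearEquivOfDetNeZero hdet with hA'
  have hA'A : ∀ x, A' x = A x := fun x => rfl
  have hin : ∀ x, ‖x‖ < 1 → c + A x ∈ Ω := by
    have hopen : IsOpen ((fun x => c + A' x) '' Metric.ball 0 1) := by
      have : (fun x => c + A' x) = (Homeomorph.addLeft c) ∘ A' := rfl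
      rw [this, Set.image_comp]
      exact (Homeomorph.addLeft c).isOpenMap _ (A'.toHomeomorph.isOpenMap _ Metric.isOpen_ball)
    have hsub : (fun x => c + A' x) '' Metric.ball 0 1 ⊆ closure Ω := by
      rintro _ ⟨x, hx, rfl⟩
      exact hcA x (mem_ball_zero_iff.1 hx).le
    have hint := interior_maximal hsub hopen
    rw [hc.interior_closure_eq_interior_of_nonempty_interior ⟨x₀, by rwa [hΩ.interior_eq]⟩,
      hΩ.interior_eq] at hint
    exact fun x hx => hint ⟨x, mem_ball_zero_iff.2 hx, rfl⟩
  refine ⟨c, A', hin, ?_⟩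
  -- In these coordinates the optimal ellipsoid is the unit ball. A larger ellipsoid `D` in `Ω'`
  -- would make `A.comp D` beat the maximum.
  set Ω' : Set E := (fun x => c + A' x) ⁻¹' Ω with hΩ'
  have hΩ'o : IsOpen Ω' := hΩ.preimage (by fun_prop)
  have hΩ'c : Convex ℝ Ω' := by
    intro x hx y hy a b ha hb hab
    have := hc hx hy ha hb hab
    rw [hΩ', Set.mem_preimage]
    convert this using 1
    rw [map_add, map_smul, map_smul]
    have : c = (a + b) • c := by rw [hab, one_smul]
    nth_rw 1 [this]
    module
  have hle : ∀ x ∈ Ω', ‖x‖ ≤ Module.finrank ℝ E := by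
    intro p hp
    by_contra! hlt
    obtain ⟨c', D, hD, hD1⟩ := exists_larger_ellipsoid hΩ'o hΩ'c
      (fun x hx => hin x (mem_ball_zero_iff.1 hx)) hp hm hlt
    have hmem : (c + A c', A.comp D) ∈ S := by
      intro x hx
      have hcl : IsClosed {y : E | c + A c' + A (D y) ∈ closure Ω} :=
        isClosed_closure.preimage (by fun_prop)
      have hsub : Metric.ball (0 : E) 1 ⊆ {y : E | c + A c' + A (D y) ∈ closure Ω} := by
        intro y hy
        have := hD y (mem_ball_zero_iff.1 hy)
        rw [hΩ', Set.mem_preimage, hA'A, map_add, ← add_assoc] at this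
        exact subset_closure this
      have h1 := closure_minimal hsub hcl
      rw [closure_ball _ one_ne_zero] at h1
      exact h1 (mem_closedBall_zero_iff.2 hx)
    have h2 := hmax hmem
    have h3 : (A.comp D).det = A.det * D.det := by
      exact LinearMap.det_comp (A : E →ₗ[ℝ] E) (D : E →ₗ[ℝ] E)
    simp only [Set.mem_ofPred_eq, h3, abs_mul] at h2
    nlinarith
  -- Openness of `Ω'` upgrades the closed ball to the open one.
  have hsub : Ω' ⊆ Metric.ball 0 (Module.finrank ℝ E) := by
    have h1 : Ω' ⊆ Metric.closedBall 0 (Module.finrank ℝ E) := fun x hx =>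
      mem_closedBall_zero_iff.2 (hle x hx)
    have h2 := interior_maximal h1 hΩ'o
    rwa [interior_closedBall] at h2
    exact_mod_cast (by omega : Module.finrank ℝ E ≠ 0)
  exact fun x hx => mem_ball_zero_iff.1 (hsub hx)

/-- Simultaneous diagonalisation of `‖B x‖²` and the inner product. -/
lemma exists_orthonormalBasis_norm_sq [FiniteDimensional ℝ E] {n : ℕ}
    (hn : Module.finrank ℝ E = n) (B : E ≃L[ℝ] E) :
    ∃ (b : OrthonormalBasis (Fin n) ℝ E) (μ : Fin n → ℝ), (∀ i, 0 < μ i) ∧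
      ∀ x, ‖B x‖ ^ 2 = ∑ i, μ i * inner ℝ (b i) x ^ 2 := by
  set M : E →L[ℝ] E := (ContinuousLinearMap.adjoint (B : E →L[ℝ] E)).comp (B : E →L[ℝ] E) with hM
  have hMxy : ∀ x y, inner ℝ (M x) y = inner ℝ (B x) (B y) := fun x y => by
    rw [hM, ContinuousLinearMap.comp_apply, ContinuousLinearMap.adjoint_inner_left]
    rfl
  have hsymm : (M : E →ₗ[ℝ] E).IsSymmetric := by
    intro x y
    simp only [ContinuousLinearMap.coe_coe]
    rw [hMxy, real_inner_comm, real_inner_comm (M y) x, hMxy]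
  set b := hsymm.eigenvectorBasis hn with hb
  set μ := hsymm.eigenvalues hn with hμ
  have hMb : ∀ i, M (b i) = μ i • b i := fun i => by
    exact hsymm.apply_eigenvectorBasis hn i
  refine ⟨b, μ, fun i => ?_, fun x => ?_⟩
  · have h1 : ‖B (b i)‖ ^ 2 = μ i := by
      rw [← real_inner_self_eq_norm_sq, ← hMxy, hMb, inner_smul_left, real_inner_self_eq_norm_sq,
        b.norm_eq_one]
      simp
    rw [← h1]
    have : B (b i) ≠ 0 := by
      rw [Ne, map_eq_zero_iff _ B.injective, ← norm_eq_zero, b.norm_eq_one]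
      norm_num
    positivity
  · rw [← real_inner_self_eq_norm_sq, ← hMxy, ← b.sum_inner_mul_inner]
    refine Finset.sum_congr rfl fun i _ => ?_
    have : inner ℝ (M x) (b i) = μ i * inner ℝ (b i) x := by
      rw [hMxy, real_inner_comm, ← hMxy, hMb, inner_smul_left]
      simp
    rw [this]
    ring

end John

/-! ### The Beta integral over the unit ball -/

section BallIntegral

lemma integral_betaPDFReal {α β : ℝ} (hα : 0 < α) (hβ : 0 < β) :
    ∫ x, ProbabilityTheory.betaPDFReal α β x = 1 := by
  have h0 : ∀ x, 0 ≤ ProbabilityTheory.betaPDFReal α β x := by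
    intro x
    by_cases hx : 0 < x ∧ x < 1
    · exact (ProbabilityTheory.betaPDFReal_pos hx.1 hx.2 hα hβ).le
    · rw [ProbabilityTheory.betaPDFReal, if_neg hx]
  rw [integral_eq_lintegral_of_nonneg_ae (ae_of_all _ h0)
    (ProbabilityTheory.stronglyMeasurable_betaPDFReal α β).aestronglyMeasurable]
  have := ProbabilityTheory.lintegral_betaPDF_eq_one hα hβ
  simp only [ProbabilityTheory.betaPDF] at this
  rw [this, ENNReal.toReal_one]

/-- The substitution `y ↦ y²` turns the integrand into a multiple of the Beta density with
parameters `m / 2` and `p + 1`. -/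
lemma integral_Ioi_pow_mul_one_sub_sq_rpow (hm : 1 ≤ m) {p : ℝ} (hp : 1 ≤ p) :
    ∫ y in Set.Ioi (0 : ℝ), y ^ (m - 1) * (if y < 1 then (1 - y ^ 2) ^ p else 0) =
      ProbabilityTheory.beta (m / 2) (p + 1) / 2 := by
  have hm' : (0 : ℝ) < m := by exact_mod_cast hm
  have hα : (0 : ℝ) < m / 2 := by positivity
  have hβ : 0 < p + 1 := by linarith
  have hB := ProbabilityTheory.beta_pos hα hβ
  have h1 := integral_comp_rpow_Ioi_of_pos
    (g := fun y : ℝ => ProbabilityTheory.betaPDFReal (m / 2) (p + 1) y) (two_pos : (0 : ℝ) < 2)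
  have h2 : ∫ y in Set.Ioi (0 : ℝ), ProbabilityTheory.betaPDFReal (m / 2) (p + 1) y = 1 := by
    refine (setIntegral_eq_integral_of_forall_compl_eq_zero fun x hx => ?_).trans
      (integral_betaPDFReal hα hβ)
    rw [ProbabilityTheory.betaPDFReal, if_neg fun h => hx h.1]
  rw [h2] at h1
  have h3 : ∀ y ∈ Set.Ioi (0 : ℝ), y ^ (m - 1) * (if y < 1 then (1 - y ^ 2) ^ p else 0) =
      ProbabilityTheory.beta (m / 2) (p + 1) / 2 * ((2 * y ^ ((2 : ℝ) - 1)) •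
        ProbabilityTheory.betaPDFReal (m / 2) (p + 1) (y ^ (2 : ℝ))) := by
    intro y hy
    have hy0 : 0 < y := hy
    have hsq : y ^ (2 : ℝ) = y ^ 2 := by exact_mod_cast Real.rpow_natCast y 2
    have hlt : (0 < y ^ 2 ∧ y ^ 2 < 1) ↔ y < 1 := by
      rw [and_iff_right (by positivity), sq_lt_one_iff₀ hy0.le]
    rw [ProbabilityTheory.betaPDFReal, hsq]
    simp only [hlt]
    split_ifs with h
    · have e1 : (y ^ 2) ^ ((m : ℝ) / 2 - 1) = y ^ ((m : ℝ) - 2) := by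
        rw [← hsq, ← Real.rpow_mul hy0.le]
        congr 1
        ring
      have e2 : y ^ (m - 1) = y * y ^ ((m : ℝ) - 2) := by
        nth_rw 2 [← Real.rpow_one y]
        rw [← Real.rpow_natCast, Nat.cast_sub hm, ← Real.rpow_add hy0]
        congr 1
        push_cast
        ring
      rw [e1, e2, add_sub_cancel_right, show (2 : ℝ) - 1 = 1 by norm_num, Real.rpow_one,
        smul_eq_mul]
      field_simp
    · simp
  rw [setIntegral_congr_fun measurableSet_Ioi h3, integral_const_mul, h1, mul_one]

/-- `∫_B (1 - |x|²)^p` over the unit ball. -/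
lemma lintegral_ball_one_sub_sq_rpow (hm : 1 ≤ m) {p : ℝ} (hp : 1 ≤ p) :
    ∫⁻ x in Metric.ball (0 : EuclideanSpace ℝ (Fin m)) 1, ENNReal.ofReal ((1 - ‖x‖ ^ 2) ^ p) =
      ENNReal.ofReal (volume.real (Metric.ball (0 : EuclideanSpace ℝ (Fin m)) 1) *
        (Real.Gamma ((m : ℝ) / 2 + 1) * Real.Gamma (p + 1) /
          Real.Gamma ((m : ℝ) / 2 + p + 1))) := by
  have hm' : (0 : ℝ) < m := by exact_mod_cast hm
  have : Nonempty (Fin m) := ⟨⟨0, hm⟩⟩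
  have h1 := integral_fun_norm_addHaar (volume : Measure (EuclideanSpace ℝ (Fin m)))
    (fun y : ℝ => if y < 1 then (1 - y ^ 2) ^ p else 0)
  simp only [finrank_euclideanSpace_fin, smul_eq_mul] at h1
  rw [integral_Ioi_pow_mul_one_sub_sq_rpow hm hp] at h1
  have h2 : ∫ x : EuclideanSpace ℝ (Fin m), (if ‖x‖ < 1 then (1 - ‖x‖ ^ 2) ^ p else 0) =
      ∫ x in Metric.ball (0 : EuclideanSpace ℝ (Fin m)) 1, (1 - ‖x‖ ^ 2) ^ p := by
    rw [← integral_indicator measurableSet_ball]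
    exact integral_congr_ae (ae_of_all _ fun x => by
      by_cases hx : ‖x‖ < 1 <;> simp [hx, Set.indicator])
  have hint : IntegrableOn (fun x : EuclideanSpace ℝ (Fin m) => (1 - ‖x‖ ^ 2) ^ p)
      (Metric.ball 0 1) := by
    have hc : Continuous fun x : EuclideanSpace ℝ (Fin m) => (1 - ‖x‖ ^ 2) ^ p :=
      (by fun_prop : Continuous fun x : EuclideanSpace ℝ (Fin m) => 1 - ‖x‖ ^ 2).rpow_const
        fun x => Or.inr (by linarith)
    exact (hc.continuousOn.integrableOn_compact (isCompact_closedBall 0 1)).mono_set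
      Metric.ball_subset_closedBall
  have hnn : 0 ≤ᵐ[volume.restrict (Metric.ball (0 : EuclideanSpace ℝ (Fin m)) 1)]
      fun x => (1 - ‖x‖ ^ 2) ^ p := by
    filter_upwards [ae_restrict_mem measurableSet_ball] with x hx
    have : ‖x‖ ^ 2 ≤ 1 := pow_le_one₀ (norm_nonneg _) (mem_ball_zero_iff.1 hx).le
    exact Real.rpow_nonneg (by linarith) _
  rw [← ofReal_integral_eq_lintegral_ofReal hint hnn, ← h2, h1]
  congr 1
  -- Polar coordinates leave the factor `m / 2`, absorbed by `Γ(m/2 + 1) = (m/2) Γ(m/2)`.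
  rw [ProbabilityTheory.beta, Real.Gamma_add_one (by positivity : (m : ℝ) / 2 ≠ 0), nsmul_eq_mul,
    ← add_assoc]
  ring

end BallIntegral

/-! ### Torsion of inscribed ellipsoids -/

section EllipsoidTorsion

variable {Ω : Set (EuclideanSpace ℝ (Fin m))}

/-- The torsion function of the ellipsoid `Σ μᵢ ⟪bᵢ, y - c⟫² < 1`. -/
def ellipsoidTorsion (b : OrthonormalBasis (Fin m) ℝ (EuclideanSpace ℝ (Fin m))) (μ : Fin m → ℝ)
    (c y : EuclideanSpace ℝ (Fin m)) : ℝ :=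
  (1 - ∑ i, μ i * inner ℝ (b i) (y - c) ^ 2) / (2 * ∑ i, μ i)

lemma hasGradientAt_ellipsoidTorsion (b : OrthonormalBasis (Fin m) ℝ (EuclideanSpace ℝ (Fin m)))
    (μ : Fin m → ℝ) (c y : EuclideanSpace ℝ (Fin m)) :
    HasGradientAt (ellipsoidTorsion b μ c)
      (-(∑ i, μ i)⁻¹ • ∑ i, (μ i * inner ℝ (b i) (y - c)) • b i) y := by
  have h1 : ∀ i, HasFDerivAt (fun y => inner ℝ (b i) (y - c)) (innerSL ℝ (b i)) y := fun i =>
    (innerSL ℝ (b i)).hasFDerivAt.comp y (hasFDerivAt_id y |>.sub_const c)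
  have h2 := ((HasFDerivAt.fun_sum (u := Finset.univ)
    fun i _ => ((h1 i).pow 2).const_mul (μ i)).const_sub 1).mul_const (2 * ∑ i, μ i)⁻¹
  rw [hasGradientAt_iff_hasFDerivAt]
  refine (h2.congr_fderiv ?_).congr_of_eventuallyEq
    (Eventually.of_forall fun y => by rw [ellipsoidTorsion, div_eq_mul_inv])
  ext z
  simp only [smul_apply, neg_apply, sum_apply, innerSL_apply_apply, smul_eq_mul, nsmul_eq_mul,
    InnerProductSpace.toDual_apply_apply, inner_smul_left, sum_inner, conj_trivial, Finset.mul_sum,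
    mul_neg, neg_mul]
  rw [← Finset.sum_neg_distrib]
  refine Finset.sum_congr rfl fun i _ => ?_
  rw [← Finset.mul_sum, mul_inv]
  push_cast
  ring

/-- The quadratic satisfies `-Δ f = 1` on the whole space and is positive only inside the ellipsoid,
so its superlevel sets at `ε > 0` are compact subsets of `Ω` and it is an admissible subsolution. -/
lemma ellipsoidTorsion_le_torsion (hm : 1 ≤ m) (hΩ : IsOpen Ω)
    (b : OrthonormalBasis (Fin m) ℝ (EuclideanSpace ℝ (Fin m))) {μ : Fin m → ℝ} (hμ : ∀ i, 0 < μ i)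
    {c : EuclideanSpace ℝ (Fin m)}
    (hsub : ∀ y, ∑ i, μ i * inner ℝ (b i) (y - c) ^ 2 < 1 → y ∈ Ω) {κ : ℝ} (hκ : 0 < κ)
    (hP : Poincare Ω κ) {v : EuclideanSpace ℝ (Fin m) → ℝ} (hv : IsTorsionFunction Ω v) :
    ∀ᵐ y ∂volume.restrict Ω, ellipsoidTorsion b μ c y ≤ v y := by
  have : Nonempty (Fin m) := ⟨⟨0, hm⟩⟩
  have hS : 0 < ∑ i, μ i := Finset.sum_pos (fun i _ => hμ i) Finset.univ_nonempty
  have hsmooth : ContDiff ℝ ∞ (ellipsoidTorsion b μ c) := by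
    have h : ∀ i, ContDiff ℝ ∞ fun y => inner ℝ (b i) (y - c) := fun i =>
      contDiff_const.inner ℝ (contDiff_id.sub contDiff_const)
    unfold ellipsoidTorsion
    fun_prop
  have := comparison (σ := 1) hΩ hκ hP hv (by norm_num) hsmooth.contDiffOn
    (fun x _ => hasGradientAt_ellipsoidTorsion b μ c x) ?_ ?_
  · simpa using this
  · intro ε hε
    simp only [one_mul]
    have hlt : ∀ y, ε ≤ ellipsoidTorsion b μ c y → ∑ i, μ i * inner ℝ (b i) (y - c) ^ 2 < 1 := by
      intro y hy
      have : 0 < ellipsoidTorsion b μ c y := hε.trans_le hy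
      rw [ellipsoidTorsion, div_pos_iff_of_pos_right (by positivity)] at this
      linarith
    refine ⟨{y | ε ≤ ellipsoidTorsion b μ c y}, Metric.isCompact_of_isClosed_isBounded
      (isClosed_le continuous_const hsmooth.continuous) ?_, fun y hy => hsub y (hlt y hy),
      fun y _ hy => hy⟩
    refine (Metric.isBounded_closedBall (x := c) (r := Real.sqrt (∑ i, (μ i)⁻¹))).subset
      fun y hy => ?_
    rw [mem_closedBall_iff_norm]
    apply Real.le_sqrt_of_sq_le
    rw [← b.sum_sq_norm_inner_right]
    refine Finset.sum_le_sum fun i _ => ?_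
    have h1 : μ i * inner ℝ (b i) (y - c) ^ 2 ≤ ∑ i, μ i * inner ℝ (b i) (y - c) ^ 2 :=
      Finset.single_le_sum (f := fun i => μ i * inner ℝ (b i) (y - c) ^ 2)
        (fun i _ => mul_nonneg (hμ i).le (sq_nonneg _)) (Finset.mem_univ i)
    rw [Real.norm_eq_abs, sq_abs, ← one_div, le_div_iff₀ (hμ i), mul_comm]
    exact h1.trans (hlt y hy).le
  · intro ψ hψ _
    rw [IsTestFunction.setIntegral_eq (fun x hx => by simp [hψ.gradient_eq_zero hx]),
      IsTestFunction.setIntegral_eq (fun x hx => hψ.eq_zero hx)]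
    have hcd := hψ.1.continuous_fderiv (by simp)
    have hibp : ∀ i, ∫ x, fderiv ℝ ψ x (b i) * inner ℝ (b i) (x - c) = -∫ x, ψ x := by
      intro i
      have := integral_mul_lineDeriv (f := fun x => inner ℝ (b i) (x - c)) (f' := fun _ => 1)
        (v := b i) hψ.1 hψ.2.1 (by fun_prop) continuousOn_const fun x _ => by
          have h1 : HasFDerivAt (fun y => inner ℝ (b i) (y - c)) (innerSL ℝ (b i)) x :=
            (innerSL ℝ (b i)).hasFDerivAt.comp x (hasFDerivAt_id x |>.sub_const c)
          simpa using h1.hasLineDerivAt (b i)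
      simp only [mul_one] at this
      linarith
    have hi : ∀ i ∈ Finset.univ, Integrable fun x =>
        -(∑ i, μ i)⁻¹ * μ i * (fderiv ℝ ψ x (b i) * inner ℝ (b i) (x - c)) := fun i _ =>
      (Continuous.integrable_of_hasCompactSupport (by fun_prop)
        ((hψ.2.1.fderiv_apply (𝕜 := ℝ) (b i)).mul_right)).const_mul _
    have heq : ∀ x, inner ℝ (-(∑ i, μ i)⁻¹ • ∑ i, (μ i * inner ℝ (b i) (x - c)) • b i)
        (gradient ψ x) =
        ∑ i, -(∑ i, μ i)⁻¹ * μ i * (fderiv ℝ ψ x (b i) * inner ℝ (b i) (x - c)) := by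
      intro x
      rw [inner_smul_left, sum_inner, Finset.mul_sum]
      refine Finset.sum_congr rfl fun i _ => ?_
      rw [inner_smul_left, inner_gradient_right]
      simp only [conj_trivial]
      ring
    simp only [heq]
    rw [integral_finsetSum _ hi]
    simp only [integral_const_mul, hibp]
    rw [← Finset.sum_mul, ← Finset.mul_sum]
    have : -(∑ i, μ i)⁻¹ * (∑ i, μ i) * -∫ x, ψ x = ∫ x, ψ x := by field_simp
    rw [this]

end EllipsoidTorsion

/-! ### Monotonicity and the lower bound for convex sets -/

section Convex

/-- By Hölder, `T p Ω / |Ω|^{1/p}` is non-decreasing in `p` for each fixed `Ω`, and λ₁ does not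
involve `p`. -/
theorem GConvex_monotoneOn : MonotoneOn (fun p : ℝ => GConvex m p) (Set.Ici 1) := by
  intro p hp q hq hpq
  have hp0 : (0 : ℝ) < p := lt_of_lt_of_le one_pos hp
  have hq0 : (0 : ℝ) < q := lt_of_lt_of_le one_pos hq
  refine le_iInf fun Ω => le_iInf fun hΩ => le_iInf fun hc => le_iInf fun hpos =>
    le_iInf fun hfin => (iInf_le_of_le Ω (iInf_le_of_le hΩ (iInf_le_of_le hc
      (iInf_le_of_le hpos (iInf_le_of_le hfin ?_)))))
  have h1 := eLpNorm_le_eLpNorm_mul_rpow_measure_univ (ENNReal.ofReal_le_ofReal hpq)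
    (aestronglyMeasurable_torsionFunction Ω)
  rw [ENNReal.toReal_ofReal hp0.le, ENNReal.toReal_ofReal hq0.le, Measure.restrict_apply_univ,
    ENNReal.rpow_sub _ _ hpos.ne' hfin.ne, ← mul_div_assoc] at h1
  have hV0 : volume Ω ^ (1 / p) ≠ 0 := (ENNReal.rpow_pos hpos hfin.ne).ne'
  have hVt : volume Ω ^ (1 / p) ≠ ⊤ := ENNReal.rpow_ne_top_of_nonneg (by positivity) hfin.ne
  have h2 : T p Ω / volume Ω ^ (1 / p) ≤ T q Ω / volume Ω ^ (1 / q) := by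
    rw [ENNReal.div_le_iff hV0 hVt]
    refine h1.trans_eq ?_
    rw [ENNReal.mul_div_right_comm]
    rfl
  rw [F, F, ENNReal.mul_div_right_comm, ENNReal.mul_div_right_comm]
  gcongr

variable {Ω : Set (EuclideanSpace ℝ (Fin m))}

lemma lintegral_image_affine (c : EuclideanSpace ℝ (Fin m))
    (A : EuclideanSpace ℝ (Fin m) ≃L[ℝ] EuclideanSpace ℝ (Fin m))
    {s : Set (EuclideanSpace ℝ (Fin m))} (hs : MeasurableSet s)
    (g : EuclideanSpace ℝ (Fin m) → ℝ≥0∞) :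
    ∫⁻ y in (fun x => c + A x) '' s, g y =
      ENNReal.ofReal |(A : EuclideanSpace ℝ (Fin m) →L[ℝ] EuclideanSpace ℝ (Fin m)).det| *
        ∫⁻ x in s, g (c + A x) := by
  rw [lintegral_image_eq_lintegral_abs_det_fderiv_mul volume hs
    (f' := fun _ => (A : EuclideanSpace ℝ (Fin m) →L[ℝ] EuclideanSpace ℝ (Fin m)))
    (fun x _ => (A.hasFDerivAt.const_add c).hasFDerivWithinAt)
    (fun x _ y _ h => A.injective (add_left_cancel h)),
    lintegral_const_mul' _ _ ENNReal.ofReal_ne_top]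

/-- Here `J` is the Jacobian of the John map, `w` the volume of the unit ball, `S` the sum of the `μ
i` and `β` the Gamma quotient. The first three cancel; `1/2` from the torsion and `1/4` from λ₁
combine to `2^{-3}`. -/
lemma convex_bound_identity {p J S w β : ℝ} (hm : 1 ≤ m) (hp : 1 ≤ p) (hJ : 0 < J) (hS : 0 < S)
    (hw : 0 < w) (hβ : 0 < β) :
    (J * ((1 / (2 * S)) ^ p * (w * β))) ^ (1 / p) * (Real.pi ^ 2 / (4 * m ^ 2) * S) /
        (J * (m ^ m * w)) ^ (1 / p) =
      2 ^ (-3 : ℝ) * Real.pi ^ 2 * (m : ℝ) ^ (-((m : ℝ) + 2 * p) / p) * β ^ (1 / p) := by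
  have hp0 : 0 < p := by linarith
  have hm' : (0 : ℝ) < m := by exact_mod_cast hm
  have e1 : (J * ((1 / (2 * S)) ^ p * (w * β))) ^ (1 / p) =
      J ^ (1 / p) * ((1 / (2 * S)) * (w ^ (1 / p) * β ^ (1 / p))) := by
    rw [Real.mul_rpow hJ.le (by positivity), Real.mul_rpow (by positivity) (by positivity),
      Real.mul_rpow hw.le hβ.le, ← Real.rpow_mul (by positivity), mul_one_div_cancel hp0.ne',
      Real.rpow_one]
  have e2 : (J * (m ^ m * w)) ^ (1 / p) =
      J ^ (1 / p) * ((m : ℝ) ^ ((m : ℝ) / p) * w ^ (1 / p)) := by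
    rw [Real.mul_rpow hJ.le (by positivity), Real.mul_rpow (by positivity) hw.le,
      ← Real.rpow_natCast, ← Real.rpow_mul hm'.le, mul_one_div]
  have e3 : (m : ℝ) ^ (-((m : ℝ) + 2 * p) / p) = ((m : ℝ) ^ ((m : ℝ) / p))⁻¹ * ((m : ℝ) ^ 2)⁻¹ := by
    have : -((m : ℝ) + 2 * p) / p = -((m : ℝ) / p) + -(2 : ℕ) := by
      push_cast
      field_simp
      ring
    rw [this, Real.rpow_add hm', Real.rpow_neg hm'.le, Real.rpow_neg hm'.le, Real.rpow_natCast]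
  have e4 : (2 : ℝ) ^ (-3 : ℝ) = 1 / 8 := by
    rw [Real.rpow_neg (by norm_num)]
    norm_num
  have h1 : 0 < J ^ (1 / p) := by positivity
  have h2 : 0 < w ^ (1 / p) := by positivity
  have h3 : 0 < (m : ℝ) ^ ((m : ℝ) / p) := by positivity
  rw [e1, e2, e3, e4]
  field_simp
  ring

theorem le_F_of_convex (hm : 1 ≤ m) (hΩ : IsOpen Ω) (hc : Convex ℝ Ω) (hpos : 0 < volume Ω)
    (hfin : volume Ω < ⊤) {p : ℝ} (hp : 1 ≤ p) :
    ENNReal.ofReal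
        ((2 : ℝ) ^ (-3 : ℝ) * Real.pi ^ 2 * (m : ℝ) ^ (-((m : ℝ) + 2 * p) / p) *
          (Real.Gamma ((m : ℝ) / 2 + 1) * Real.Gamma (p + 1) /
            Real.Gamma ((m : ℝ) / 2 + p + 1)) ^ (1 / p)) ≤ F p Ω := by
  have hp0 : 0 < p := by linarith
  have hm' : (0 : ℝ) < m := by exact_mod_cast hm
  have : Nonempty (Fin m) := ⟨⟨0, hm⟩⟩
  have hne : Ω.Nonempty := nonempty_of_measure_ne_zero hpos.ne'
  have hfr : Module.finrank ℝ (EuclideanSpace ℝ (Fin m)) = m := finrank_euclideanSpace_fin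
  obtain ⟨c, A, hin, hout⟩ := exists_john_ellipsoid hΩ hc hne
    (isBounded_of_convex_of_volume_lt_top hΩ hc hne hfin) (by rwa [hfr])
  rw [hfr] at hout
  obtain ⟨b, μ, hμ, hb⟩ := exists_orthonormalBasis_norm_sq hfr A.symm
  have hAs : ∀ y, c + A (A.symm (y - c)) = y := fun y => by simp
  set S := ∑ i, μ i with hSdef
  have hS : 0 < S := Finset.sum_pos (fun i _ => hμ i) Finset.univ_nonempty
  have hsub : ∀ y, ∑ i, μ i * inner ℝ (b i) (y - c) ^ 2 < 1 → y ∈ Ω := by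
    intro y hy
    rw [← hb] at hy
    have := hin (A.symm (y - c)) (by
      have := (sq_lt_one_iff₀ (norm_nonneg _)).1 hy
      exact this)
    rwa [hAs] at this
  -- The dilated ellipsoid has semi-axes `m / √(μ i)`, so it lies in the box with these half-widths.
  have hbox : ∀ y ∈ Ω, ∀ i, |inner ℝ (b i) (y - c)| < m / Real.sqrt (μ i) := by
    intro y hy i
    have h1 : ‖A.symm (y - c)‖ < m := hout _ (by rwa [hAs])
    have h2 : μ i * inner ℝ (b i) (y - c) ^ 2 ≤ ‖A.symm (y - c)‖ ^ 2 := by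
      rw [hb]
      exact Finset.single_le_sum (f := fun i => μ i * inner ℝ (b i) (y - c) ^ 2)
        (fun i _ => mul_nonneg (hμ i).le (sq_nonneg _)) (Finset.mem_univ i)
    have h3 := Real.sqrt_pos.2 (hμ i)
    rw [lt_div_iff₀ h3]
    refine lt_of_pow_lt_pow_left₀ 2 hm'.le ?_
    rw [mul_pow, sq_abs, Real.sq_sqrt (hμ i).le, mul_comm]
    exact h2.trans_lt (pow_lt_pow_left₀ h1 (norm_nonneg _) two_ne_zero)
  have hκ : ∑ i, (Real.pi / (2 * (m / Real.sqrt (μ i)))) ^ 2 = Real.pi ^ 2 / (4 * m ^ 2) * S := by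
    rw [hSdef, Finset.mul_sum]
    refine Finset.sum_congr rfl fun i _ => ?_
    have h3 := Real.sqrt_pos.2 (hμ i)
    have h4 := Real.sq_sqrt (hμ i).le
    field_simp
    rw [h4]
    ring
  have hP := poincare_of_box b (fun i => div_pos hm' (Real.sqrt_pos.2 (hμ i))) hbox
  rw [hκ] at hP
  have hκ0 : 0 < Real.pi ^ 2 / (4 * m ^ 2) * S := by positivity
  have hlam := hP.le_lambda1 hκ0.le
  have hle := ellipsoidTorsion_le_torsion hm hΩ b hμ hsub hκ0 hP
    (torsionFunction_spec (exists_isTorsionFunction hfin hκ0 hP))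
  set J := |(A : EuclideanSpace ℝ (Fin m) →L[ℝ] EuclideanSpace ℝ (Fin m)).det| with hJdef
  set w := volume.real (Metric.ball (0 : EuclideanSpace ℝ (Fin m)) 1) with hw
  set β := Real.Gamma ((m : ℝ) / 2 + 1) * Real.Gamma (p + 1) / Real.Gamma ((m : ℝ) / 2 + p + 1)
    with hβ
  have hβ0 : 0 < β := div_pos (mul_pos (Real.Gamma_pos_of_pos (by positivity))
    (Real.Gamma_pos_of_pos (by positivity))) (Real.Gamma_pos_of_pos (by positivity))
  have hw0 : 0 < w := ENNReal.toReal_pos (Metric.measure_ball_pos _ _ one_pos).ne'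
    measure_ball_lt_top.ne
  have hJ : 0 < J := abs_pos.2 (by
    have := (LinearEquiv.isUnit_det' A.toLinearEquiv).ne_zero
    exact this)
  have hT : ENNReal.ofReal ((J * ((1 / (2 * S)) ^ p * (w * β))) ^ (1 / p)) ≤ T p Ω := by
    rw [T, eLpNorm_eq_lintegral_rpow_enorm_toReal (by simpa using hp0) ENNReal.ofReal_ne_top,
      ENNReal.toReal_ofReal hp0.le, ← ENNReal.ofReal_rpow_of_nonneg (by positivity) (by positivity)]
    gcongr
    have hsubset : (fun x => c + A x) '' Metric.ball 0 1 ⊆ Ω := by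
      rintro _ ⟨x, hx, rfl⟩
      exact hin x (mem_ball_zero_iff.1 hx)
    calc ENNReal.ofReal (J * ((1 / (2 * S)) ^ p * (w * β))) =
        ∫⁻ y in (fun x => c + A x) '' Metric.ball 0 1,
          ENNReal.ofReal (ellipsoidTorsion b μ c y) ^ p := by
          rw [lintegral_image_affine c A measurableSet_ball, ENNReal.ofReal_mul hJ.le,
            ENNReal.ofReal_mul (by positivity), ← lintegral_ball_one_sub_sq_rpow hm hp,
            ← lintegral_const_mul' _ _ ENNReal.ofReal_ne_top]
          congr 1
          refine setLIntegral_congr_fun measurableSet_ball fun x hx => ?_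
          have hx1 : ‖x‖ ^ 2 ≤ 1 := pow_le_one₀ (norm_nonneg _) (mem_ball_zero_iff.1 hx).le
          have : ellipsoidTorsion b μ c (c + A x) = 1 / (2 * S) * (1 - ‖x‖ ^ 2) := by
            rw [ellipsoidTorsion, ← hb, add_sub_cancel_left, A.symm_apply_apply]
            ring
          rw [this, ENNReal.ofReal_rpow_of_nonneg (mul_nonneg (by positivity) (by linarith)) hp0.le,
            Real.mul_rpow (by positivity) (by linarith), ENNReal.ofReal_mul (by positivity)]
      _ ≤ ∫⁻ y in Ω, ENNReal.ofReal (ellipsoidTorsion b μ c y) ^ p := lintegral_mono_set hsubset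
      _ ≤ ∫⁻ y in Ω, ‖torsionFunction Ω y‖ₑ ^ p := by
          refine lintegral_mono_ae ?_
          filter_upwards [hle] with y hy
          gcongr
          refine (ENNReal.ofReal_le_ofReal (hy.trans (le_abs_self _))).trans_eq ?_
          rw [← Real.norm_eq_abs, ofReal_norm]
  have hV : volume Ω ^ (1 / p) ≤ ENNReal.ofReal ((J * (m ^ m * w)) ^ (1 / p)) := by
    rw [← ENNReal.ofReal_rpow_of_nonneg (by positivity) (by positivity)]
    gcongr
    have hsubset : Ω ⊆ (fun x => c + A x) '' Metric.ball 0 m := fun y hy =>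
      ⟨A.symm (y - c), mem_ball_zero_iff.2 (hout _ (by rwa [hAs])), hAs y⟩
    refine (measure_mono hsubset).trans_eq ?_
    rw [← setLIntegral_one, lintegral_image_affine c A measurableSet_ball, setLIntegral_one,
      Measure.addHaar_ball_of_pos _ _ hm', hfr, ENNReal.ofReal_mul hJ.le,
      ENNReal.ofReal_mul (by positivity), hw, ofReal_measureReal measure_ball_lt_top.ne]
  rw [← convex_bound_identity hm hp hJ hS hw0 hβ0,
    ENNReal.ofReal_div_of_pos (by positivity), ENNReal.ofReal_mul (by positivity), F]
  exact ENNReal.div_le_div (mul_le_mul' hT hlam) hV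

end Convex

end Torsion

end

theorem theorem2 (m : ℕ) (hm : 1 ≤ m) :
    (∀ p : ℝ, 1 ≤ p → Torsion.G m p = 0) ∧
    MonotoneOn (fun p : ℝ => Torsion.GConvex m p) (Set.Ici 1) ∧
    (∀ p : ℝ, 1 ≤ p →
      ENNReal.ofReal
        ((2 : ℝ) ^ (-3 : ℝ) * Real.pi ^ 2 * (m : ℝ) ^ (-((m : ℝ) + 2 * p) / p) *
          (Real.Gamma ((m : ℝ) / 2 + 1) * Real.Gamma (p + 1) /
            Real.Gamma ((m : ℝ) / 2 + p + 1)) ^ (1 / p)) ≤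
        Torsion.GConvex m p) :=
  ⟨fun _ hp => Torsion.G_eq_zero hm hp, Torsion.GConvex_monotoneOn, fun _ hp =>
    le_iInf fun _ => le_iInf fun hΩ => le_iInf fun hc => le_iInf fun hpos => le_iInf fun hfin =>
      Torsion.le_F_of_convex hm hΩ hc hpos hfin hp⟩
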